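/- Let $K$ be a non-archimedean local field and let $\mathbb{C}_p$ be the completion of an algebraic closure of $K$ (or, more generally, any complete algebraically closed valued extension field of $K$). Let $\Gamma\subset\mathrm{PGL}_2(K)$ be a Schottky group, i.e. a discrete, finitely generated, torsion-free subgroup, acting by Möbius transformations on $\mathbb{P}^1(\mathbb{C}_p)$. Let $\mathscr{L}\subset\mathbb{P}^1(\mathbb{C}_p)$ be its set of limit points, i.e. of limits of sequences $\gamma_n(q)$ with $q\in\mathbb{P}^1(\mathbb{C}_p)$ and pairwise distinct $\gamma_n\in\Gamma$, and let $\Omega=\mathbb{P}^1(\mathbb{C}_p)\setminus\mathscr{L}$. Put $G_\Gamma=\mathrm{Hom}(\Gamma,\mathbb{C}_p^\times)$. For $a,b\in\Omega$ and $z,w\in\Omega\setminus(\Gamma a\cup\Gamma b)$ let $$\theta(a,b;z)=\theta_w(a,b;z)=\prod_{\gamma\in\Gamma}\frac{z-\gamma(a)}{z-\gamma(b)}\cdot\frac{w-\gamma(b)}{w-\gamma(a)},$$ the factors being cross-ratios on $\mathbb{P}^1$ (for $w=\infty$ this is $\prod_\gamma\frac{z-\gamma(a)}{z-\gamma(b)}$).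 Its automorphy factor is the character $c(a,b;\cdot)\in G_\Gamma$ with $\theta_w(a,b;z)=c(a,b;\alpha)\,\theta_w(a,b;\alpha z)$ for all $\alpha\in\Gamma$ and all $z,w\in\Omega\setminus(\Gamma a\cup\Gamma b)$. For $\gamma\in\Gamma$ let $u_\gamma(z)=\theta(a,\gamma a;z)$ and $c_\gamma=c(a,\gamma a;\cdot)$, and let $\Lambda_\Gamma=\{c_\gamma\mid\gamma\in\Gamma\}\subset G_\Gamma$. Let $Q(c_\alpha,c_\beta)=u_\alpha(z)/u_\alpha(\beta z)$, and let $P\colon\Lambda_\Gamma\times\Lambda_\Gamma\to\mathbb{C}_p^\times$ be a symmetric multiplicatively bilinear form with $P^2=Q$. Finally let $$\xi_{c_\gamma}(c)=P(c_\gamma,c_\gamma)\,c(\gamma)\quad(c\in G_\Gamma),\qquad \theta_\Gamma(c)=\sum_{c_\gamma\in\Lambda_\Gamma}\xi_{c_\gamma}(c).$$ These objects are well defined: the products $u_\gamma(z)$ converge to non-zero values for $z,w\in\Omega\setminus\Gamma a$; the automorphy factor $c_\gamma$ exists and does not depend on $a\in\Omega$; a form $P$ as above exists; and for every such $P$, $\xi_{c_\gamma}(c)$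 depends only on $c_\gamma$ and $c$, and the series $\theta_\Gamma(c)$ converges for every $c\in G_\Gamma$. For every such $P$, all $\alpha,\beta\in\Gamma$ and all $c\in G_\Gamma$, $$P(c_{\alpha\beta},c_{\alpha\beta})=P(c_\alpha,c_\alpha)\,c_\alpha(\beta)\,P(c_\beta,c_\beta)$$ and the Riemann theta function satisfies $$\theta_\Gamma(c\,c_\alpha)=\xi_{c_\alpha}(c)^{-1}\,\theta_\Gamma(c).$$ -/

import Mathlib

open scoped MatrixGroups LinearAlgebra.Projectivization Topology
open Matrix Filter

noncomputable section

namespace Mumford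

/-- The quotient topology on `PGL₂(K)`. -/
instance pglTopology (K : Type*) [NontriviallyNormedField K] : TopologicalSpace PGL(2, K) :=
  TopologicalSpace.coinduced (ProjGenLinGroup.mk : GL (Fin 2) K →* PGL(2, K)) inferInstance

/-- A Schottky group over the local field `K`: a discrete, finitely generated, torsion-free
subgroup of `PGL₂(K)`. -/
structure IsSchottky {K : Type*} [NontriviallyNormedField K] (Γ : Subgroup PGL(2, K)) : Prop where
  discrete : DiscreteTopology Γ
  fg : Γ.FG
  torsionFree : ∀ γ ∈ Γ, IsOfFinOrder γ → γ = 1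

/-- The projective line over `C`. -/
abbrev P1 (C : Type*) [Field C] : Type _ := ℙ C (Fin 2 → C)

section Line

variable {C : Type*} [NormedField C]

/-- The determinant of homogeneous coordinates of two points; for `x = [u : 1]` and `y = [v : 1]`
it is `u - v` up to the choice of the coordinates. -/
def bracket (x y : P1 C) : C := x.rep 0 * y.rep 1 - x.rep 1 * y.rep 0

/-- The cross ratio `((z - a) / (z - b)) / ((w - a) / (w - b))`. It does not depend on the chosen
homogeneous coordinates, and for `w = ∞` it is `(z - a) / (z - b)`. -/
def crossRatio (z w a b : P1 C) : C :=
  (bracket z a * bracket w b) / (bracket z b * bracket w a)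

/-- The projective metric on `P1 C`, which induces its usual topology. -/
def chordalDist (x y : P1 C) : ℝ := ‖bracket x y‖ / (‖x.rep‖ * ‖y.rep‖)

end Line

variable {K : Type*} [NontriviallyNormedField K] {C : Type*} [NormedField C] [NormedAlgebra K C]

/-- The action of `PGL₂(K)` on the projective line over `C` by Moebius transformations. -/
def act (g : PGL(2, K)) (x : P1 C) : P1 C := ProjGenLinGroup.map (algebraMap K C) g • x

/-- The limit points of `Γ` in `P1 C`: limits of sequences `γₙ q` with the `γₙ ∈ Γ` pairwise
distinct. -/
def limitSet (C : Type*) [NormedField C] [NormedAlgebra K C] (Γ : Subgroup PGL(2, K)) :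
    Set (P1 C) :=
  {x | ∃ (q : P1 C) (γ : ℕ → Γ), Function.Injective γ ∧
    Tendsto (fun n => chordalDist (act (γ n : PGL(2, K)) q) x) atTop (𝓝 0)}

/-- The set `Ω` of ordinary points of `Γ`. -/
def ordinarySet (C : Type*) [NormedField C] [NormedAlgebra K C] (Γ : Subgroup PGL(2, K)) :
    Set (P1 C) :=
  (limitSet C Γ)ᶜ

/-- The points of `Ω` outside the orbits `Γ a` and `Γ b`. -/
def regularSet (Γ : Subgroup PGL(2, K)) (a b : P1 C) : Set (P1 C) :=
  {z | z ∈ ordinarySet C Γ ∧ ∀ γ : Γ, z ≠ act (γ : PGL(2, K)) a ∧ z ≠ act (γ : PGL(2, K)) b}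

/-- `θ(a, b; z) = ∏_γ (z - γ a) / (z - γ b)`, normalised to take the value `1` at `z = w`. For
`w = ∞` this is the product without normalisation. -/
def theta (Γ : Subgroup PGL(2, K)) (w a b z : P1 C) : C :=
  ∏' γ : Γ, crossRatio z w (act (γ : PGL(2, K)) a) (act (γ : PGL(2, K)) b)

/-- The character group `G_Γ = Hom(Γ, Cˣ)`. -/
abbrev CharGroup (C : Type*) [NormedField C] (Γ : Subgroup PGL(2, K)) : Type _ := Γ →* Cˣ

/-- `χ` is the automorphy factor of `θ(a, b; ·)`, that is `θ(a, b; z) = χ(α) θ(a, b; α z)`. -/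
def IsAutomorphyFactor (Γ : Subgroup PGL(2, K)) (a b : P1 C) (χ : CharGroup C Γ) : Prop :=
  ∀ w ∈ regularSet Γ a b, ∀ z ∈ regularSet Γ a b, ∀ α : Γ,
    theta Γ w a b z = (χ α : C) * theta Γ w a b (act (α : PGL(2, K)) z)

open scoped Classical in
/-- The automorphy factor `c(a, b; ·)` of `θ(a, b; ·)`. -/
def automorphyFactor (Γ : Subgroup PGL(2, K)) (a b : P1 C) : CharGroup C Γ :=
  if h : ∃ χ : CharGroup C Γ, IsAutomorphyFactor Γ a b χ then h.choose else 1

/-- The character `c_γ = c(a, γ a; ·)`. -/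
def periodChar (Γ : Subgroup PGL(2, K)) (a : P1 C) (γ : Γ) : CharGroup C Γ :=
  automorphyFactor Γ a (act (γ : PGL(2, K)) a)

/-- The period lattice `Λ_Γ = {c_γ | γ ∈ Γ}` in `G_Γ`. -/
def periodLattice (Γ : Subgroup PGL(2, K)) (a : P1 C) : Set (CharGroup C Γ) :=
  Set.range (periodChar Γ a)

/-- `c_γ` as an element of `Λ_Γ`. -/
def periodElt (Γ : Subgroup PGL(2, K)) (a : P1 C) (γ : Γ) : periodLattice Γ a :=
  ⟨periodChar Γ a γ, γ, rfl⟩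

/-- `P` is a symmetric multiplicatively bilinear form on `Λ_Γ` with `P² = Q`, where
`Q(c_α, c_β) = u_α(z) / u_α(β z)` and `u_α(z) = θ(a, α a; z)`. -/
structure IsPeriodRoot (Γ : Subgroup PGL(2, K)) (a : P1 C)
    (P : periodLattice Γ a → periodLattice Γ a → Cˣ) : Prop where
  symm : ∀ l m, P l m = P m l
  mul_left : ∀ k l m n : periodLattice Γ a,
    (k : CharGroup C Γ) = (l : CharGroup C Γ) * (m : CharGroup C Γ) → P k n = P l n * P m n
  sq : ∀ α β : Γ, ∀ w ∈ regularSet Γ a (act (α : PGL(2, K)) a),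
    ∀ z ∈ regularSet Γ a (act (α : PGL(2, K)) a),
      (P (periodElt Γ a α) (periodElt Γ a β) : C) ^ 2 =
        theta Γ w a (act (α : PGL(2, K)) a) z /
          theta Γ w a (act (α : PGL(2, K)) a) (act (β : PGL(2, K)) z)

/-- `ξ_l(c) = P(l, l) c(γ)` for `l = c_γ ∈ Λ_Γ`. -/
def xi {Γ : Subgroup PGL(2, K)} {a : P1 C} (P : periodLattice Γ a → periodLattice Γ a → Cˣ)
    (l : periodLattice Γ a) (c : CharGroup C Γ) : Cˣ :=
  P l l * c l.2.choose

/-- The Riemann theta function `θ_Γ(c) = ∑_{l ∈ Λ_Γ} ξ_l(c)`. -/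
def riemannTheta {Γ : Subgroup PGL(2, K)} {a : P1 C}
    (P : periodLattice Γ a → periodLattice Γ a → Cˣ) (c : CharGroup C Γ) : C :=
  ∑' l : periodLattice Γ a, (xi P l c : C)

end Mumford

end

/-! Write `q γ α` for the value c_γ(α). The cross-ratio is invariant under Γ, so inverting the
summation index exchanges the pairs (z, w) and (a, b) in the theta product (`theta_symm`). The
automorphy factor of θ(b, γb; ·) at α is θ_{αz}(b, γb; z) (`period`). It does not depend on z or b
and is multiplicative in α, and by reciprocity it is symmetric in γ and α. Hence `q` is a symmetric
bimultiplicative pairing on Γ. Granted this, the cocycle rule for P follows by expanding P(c_α c_β,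
c_α c_β), and the functional equation follows by translating the summation index by c_α.

Three points are not formal: c_γ = c_δ must imply c(γ) = c(δ) for every character c, the theta
series must converge, and P must exist. All three come from the quotient by Γ of the Bruhat-Tits
tree of PGL₂(K). Let F γ be the integral chain on the quotient graph given by a path from the
standard vertex v to γv. Then |q(γ, α)| = |π|^⟨F γ, F α⟩ for the standard positive definite form
(`IsGeneric.norm_period`), and since Γ acts freely on the vertices, every character of Γ is a
cochain evaluated on F γ (`TreeDatum.exists_cochain`). These facts are collected in
`IsPolarization`. By definiteness F is additive and c_γ determines F γ, hence every c(γ). The term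
P(c_γ, c_γ) decays like the exponential of a negative quadratic form in F γ, while c(γ) grows at
most like the exponential of a linear one, so the terms tend to 0, which suffices in the ultrametric
setting. Finally F(Γ) is a free abelian group of finite rank, and P is built from square roots of
`q` on a basis (`IsPolarization.exists_root`).

For the absolute value, `q` is computed at z = [t² : 1] and b = [t : 1], where no nontrivial
polynomial of degree at most three over the residue field of K vanishes at the residue of t
(`exists_generic`). For such t the bracket of z with M b has norm equal to the largest entry of M,
so the logarithm of each factor of the product is a mixed second difference of half the logarithm of
`rho`, which is half the tree distance (`IsGeneric.log_norm_crossRatio`). Across two edges this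
second difference vanishes unless the edges coincide up to orientation (`treePotential`). Adding up
along the two paths and then over Γ counts signed coincidences of edges in the quotient graph, which
is the pairing of the chains (`TreePotential.hasSum`). -/

noncomputable section

namespace Mumford

section

/-! ### Norms of matrices and displacement of the standard vertex. -/

section Entries

variable {K : Type*} [NormedField K]

/-- The maximum of the norms of the entries of a `2 × 2` matrix. -/
def entryNorm (M : Matrix (Fin 2) (Fin 2) K) : ℝ :=
  max (max ‖M 0 0‖ ‖M 0 1‖) (max ‖M 1 0‖ ‖M 1 1‖)

lemma norm_le_entryNorm (M : Matrix (Fin 2) (Fin 2) K) (i j : Fin 2) : ‖M i j‖ ≤ entryNorm M := by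
  fin_cases i <;> fin_cases j <;> simp [entryNorm]

lemma entryNorm_le {M : Matrix (Fin 2) (Fin 2) K} {r : ℝ} (h : ∀ i j, ‖M i j‖ ≤ r) :
    entryNorm M ≤ r := by
  simp [entryNorm, h]

lemma entryNorm_nonneg (M : Matrix (Fin 2) (Fin 2) K) : 0 ≤ entryNorm M :=
  (norm_nonneg _).trans (norm_le_entryNorm M 0 0)

lemma exists_norm_eq_entryNorm (M : Matrix (Fin 2) (Fin 2) K) : ∃ i j, ‖M i j‖ = entryNorm M := by
  unfold entryNorm
  rcases max_choice (max ‖M 0 0‖ ‖M 0 1‖) (max ‖M 1 0‖ ‖M 1 1‖) with h | h <;> rw [h]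
  · rcases max_choice ‖M 0 0‖ ‖M 0 1‖ with h | h <;> rw [h]
    exacts [⟨0, 0, rfl⟩, ⟨0, 1, rfl⟩]
  · rcases max_choice ‖M 1 0‖ ‖M 1 1‖ with h | h <;> rw [h]
    exacts [⟨1, 0, rfl⟩, ⟨1, 1, rfl⟩]

lemma entryNorm_pos {M : Matrix (Fin 2) (Fin 2) K} (h : M ≠ 0) : 0 < entryNorm M := by
  refine lt_of_le_of_ne (entryNorm_nonneg M) fun h0 => h ?_
  ext i j
  have := norm_le_entryNorm M i j
  rw [← h0] at this
  simpa using this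

lemma entryNorm_smul (c : K) (M : Matrix (Fin 2) (Fin 2) K) :
    entryNorm (c • M) = ‖c‖ * entryNorm M := by
  simp [entryNorm, mul_max_of_nonneg]

lemma continuous_entryNorm : Continuous (entryNorm : Matrix (Fin 2) (Fin 2) K → ℝ) := by
  unfold entryNorm
  fun_prop

lemma entryNorm_adjugate (M : Matrix (Fin 2) (Fin 2) K) : entryNorm M.adjugate = entryNorm M := by
  simp only [entryNorm, Matrix.adjugate_fin_two, of_apply, cons_val', cons_val_zero, cons_val_one,
    norm_neg, cons_val_fin_one]
  rw [max_comm ‖M 0 0‖, max_comm (max ‖M 1 1‖ _), max_comm ‖M 1 0‖]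
  simp only [max_assoc, max_left_comm, max_comm]

variable [IsUltrametricDist K]

lemma norm_add_mul_le {a b c d : K} {r s : ℝ} (ha : ‖a‖ ≤ r) (hc : ‖c‖ ≤ r) (hb : ‖b‖ ≤ s)
    (hd : ‖d‖ ≤ s) : ‖a * b + c * d‖ ≤ r * s := by
  refine (IsUltrametricDist.norm_add_le_max _ _).trans (max_le ?_ ?_) <;> rw [norm_mul]
  · exact mul_le_mul ha hb (norm_nonneg _) ((norm_nonneg _).trans ha)
  · exact mul_le_mul hc hd (norm_nonneg _) ((norm_nonneg _).trans hc)

lemma entryNorm_mul_le (M N : Matrix (Fin 2) (Fin 2) K) :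
    entryNorm (M * N) ≤ entryNorm M * entryNorm N := by
  refine entryNorm_le fun i j => ?_
  rw [Matrix.mul_apply, Fin.sum_univ_two]
  exact norm_add_mul_le (norm_le_entryNorm _ _ _) (norm_le_entryNorm _ _ _)
    (norm_le_entryNorm _ _ _) (norm_le_entryNorm _ _ _)

lemma norm_det_le (M : Matrix (Fin 2) (Fin 2) K) : ‖M.det‖ ≤ entryNorm M ^ 2 := by
  rw [Matrix.det_fin_two, sub_eq_add_neg, ← neg_mul, pow_two]
  exact norm_add_mul_le (norm_le_entryNorm _ _ _) ((norm_neg _).trans_le (norm_le_entryNorm _ _ _))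
    (norm_le_entryNorm _ _ _) (norm_le_entryNorm _ _ _)

end Entries

section Rho

variable {K : Type*} [NormedField K]

lemma val_ne_zero (G : GL (Fin 2) K) : (G : Matrix (Fin 2) (Fin 2) K) ≠ 0 := fun h => by
  have := G.det.ne_zero
  simp [h] at this

lemma det_ne_zero (G : GL (Fin 2) K) : (G : Matrix (Fin 2) (Fin 2) K).det ≠ 0 := by
  simpa using G.det.ne_zero

lemma val_scalar_mul (u : Kˣ) (G : GL (Fin 2) K) :
    ((G * .scalar (Fin 2) u : GL (Fin 2) K) : Matrix (Fin 2) (Fin 2) K) = (u : K) • G.val := by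
  ext i j
  fin_cases i <;> fin_cases j <;>
    simp [Matrix.mul_apply, mul_comm]

lemma exists_normalized_lift (g : PGL(2, K)) :
    ∃ G : GL (Fin 2) K, ProjGenLinGroup.mk G = g ∧ entryNorm G.val = 1 := by
  obtain ⟨G, rfl⟩ := ProjGenLinGroup.mk_surjective g
  obtain ⟨i, j, hij⟩ := exists_norm_eq_entryNorm G.val
  have h0 := entryNorm_pos (val_ne_zero G)
  have hne : G.val i j ≠ 0 := by
    rw [← norm_pos_iff, hij]
    exact h0
  refine ⟨G * .scalar (Fin 2) (Units.mk0 _ hne)⁻¹, by simp, ?_⟩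
  rw [val_scalar_mul, entryNorm_smul]
  simp only [Units.val_inv_eq_inv_val, Units.val_mk0, norm_inv, hij]
  exact inv_mul_cancel₀ h0.ne'

/-- A lift of an element of `PGL₂(K)` to a matrix whose largest entry has norm `1`. -/
def lift (g : PGL(2, K)) : GL (Fin 2) K := (exists_normalized_lift g).choose

@[simp] lemma mk_lift (g : PGL(2, K)) : ProjGenLinGroup.mk (lift g) = g :=
  (exists_normalized_lift g).choose_spec.1

@[simp] lemma entryNorm_lift (g : PGL(2, K)) : entryNorm (lift g).val = 1 :=
  (exists_normalized_lift g).choose_spec.2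

/-- The function `‖M‖² / ‖det M‖` on `PGL₂(K)`: the exponential of the displacement of the
standard vertex of the Bruhat-Tits tree. -/
def rho (g : PGL(2, K)) : ℝ := ‖(lift g).val.det‖⁻¹

lemma rho_mk (G : GL (Fin 2) K) :
    rho (ProjGenLinGroup.mk G) = entryNorm G.val ^ 2 / ‖G.val.det‖ := by
  obtain ⟨u, hu⟩ := ProjGenLinGroup.mk_eq_mk_iff.1 (mk_lift (ProjGenLinGroup.mk G))
  have h1 : G.val = (u : K) • (lift (ProjGenLinGroup.mk G)).val := by
    rw [← val_scalar_mul, hu]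
  have h2 : ‖(u : K)‖ ≠ 0 := by simp
  have h3 := det_ne_zero (lift (ProjGenLinGroup.mk G))
  rw [rho, h1, entryNorm_smul, entryNorm_lift, Matrix.det_smul]
  simp only [Fintype.card_fin, norm_mul, norm_pow]
  field_simp

lemma rho_pos (g : PGL(2, K)) : 0 < rho g :=
  inv_pos.2 (norm_pos_iff.2 (det_ne_zero _))

lemma rho_inv (g : PGL(2, K)) : rho g⁻¹ = rho g := by
  obtain ⟨G, rfl⟩ := ProjGenLinGroup.mk_surjective g
  have hd := norm_ne_zero_iff.2 (det_ne_zero G)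
  rw [← map_inv, rho_mk, rho_mk, Matrix.coe_units_inv, Matrix.inv_def, entryNorm_smul,
    entryNorm_adjugate, Matrix.det_smul, Matrix.det_adjugate]
  simp only [Ring.inverse_eq_inv', Fintype.card_fin, norm_mul, norm_pow, norm_inv]
  field_simp
  norm_num [mul_comm]

lemma rho_one : rho (1 : PGL(2, K)) = 1 := by
  rw [← map_one ProjGenLinGroup.mk, rho_mk]
  simp [entryNorm]

variable [IsUltrametricDist K]

lemma one_le_rho (g : PGL(2, K)) : 1 ≤ rho g := by
  have := norm_det_le (lift g).val
  rw [entryNorm_lift, one_pow] at this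
  exact (one_le_inv₀ (norm_pos_iff.2 (det_ne_zero _))).2 this

lemma rho_mul_le (g h : PGL(2, K)) : rho (g * h) ≤ rho g * rho h := by
  have h1 := norm_pos_iff.2 (det_ne_zero (lift g))
  have h2 := norm_pos_iff.2 (det_ne_zero (lift h))
  have h3 := entryNorm_mul_le (lift g).val (lift h).val
  have h4 := entryNorm_nonneg ((lift g).val * (lift h).val)
  rw [entryNorm_lift, entryNorm_lift, one_mul] at h3
  conv_lhs => rw [← mk_lift g, ← mk_lift h, ← map_mul, rho_mk]
  rw [Units.val_mul, Matrix.det_mul, norm_mul, rho, rho, ← mul_inv, div_eq_mul_inv]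
  exact mul_le_of_le_one_left (by positivity) (pow_le_one₀ h4 h3)

/-- The stabiliser of the standard vertex of the Bruhat-Tits tree. -/
def vertexStab (K : Type*) [NormedField K] [IsUltrametricDist K] : Subgroup PGL(2, K) where
  carrier := {g | rho g = 1}
  one_mem' := rho_one
  mul_mem' {g h} hg hh := by
    refine le_antisymm ?_ (one_le_rho _)
    have := rho_mul_le g h
    rwa [show rho g = 1 from hg, show rho h = 1 from hh, one_mul] at this
  inv_mem' {g} hg := (rho_inv g).trans hg

lemma mem_vertexStab {g : PGL(2, K)} : g ∈ vertexStab K ↔ rho g = 1 := Iff.rfl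

lemma rho_mul_right {g u : PGL(2, K)} (hu : u ∈ vertexStab K) : rho (g * u) = rho g := by
  refine le_antisymm ?_ ?_
  · simpa [mem_vertexStab.1 hu] using rho_mul_le g u
  · simpa [mem_vertexStab.1 (inv_mem hu)] using rho_mul_le (g * u) u⁻¹

lemma rho_mul_left {g u : PGL(2, K)} (hu : u ∈ vertexStab K) : rho (u * g) = rho g := by
  rw [← rho_inv, _root_.mul_inv_rev, rho_mul_right (inv_mem hu), rho_inv]

end Rho

/-! ### Cross-ratios and the chordal metric. -/

section Vectors

variable {C : Type*} [NormedField C]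

/-- The determinant of two vectors. -/
def wedge (v w : Fin 2 → C) : C := v 0 * w 1 - v 1 * w 0

lemma wedge_smul_left (c : C) (v w : Fin 2 → C) : wedge (c • v) w = c * wedge v w := by
  simp [wedge]; ring

lemma wedge_smul_right (c : C) (v w : Fin 2 → C) : wedge v (c • w) = c * wedge v w := by
  simp [wedge]; ring

lemma wedge_comm (v w : Fin 2 → C) : wedge v w = -wedge w v := by
  simp [wedge]; ring

lemma wedge_plucker (z w a b : Fin 2 → C) :
    wedge z a * wedge w b - wedge z b * wedge w a = wedge z w * wedge a b := by
  simp [wedge]; ring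

lemma wedge_eq_zero_iff {v w : Fin 2 → C} (hv : v ≠ 0) (hw : w ≠ 0) :
    wedge v w = 0 ↔ Projectivization.mk C v hv = Projectivization.mk C w hw := by
  rw [Projectivization.mk_eq_mk_iff']
  constructor
  · intro h
    have h' : v 0 * w 1 = v 1 * w 0 := sub_eq_zero.1 h
    by_cases h0 : w 0 = 0
    · have h1 : w 1 ≠ 0 := fun h1 => hw (by ext i; fin_cases i <;> simp [h0, h1])
      have : v 0 = 0 := by simpa [h0, h1] using h'
      exact ⟨v 1 / w 1, by ext i; fin_cases i <;> simp [h0, this, h1]⟩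
    · refine ⟨v 0 / w 0, ?_⟩
      ext i
      fin_cases i
      · simp [h0]
      · simp only [Fin.mk_one, Pi.smul_apply, smul_eq_mul]
        field_simp
        rw [mul_comm (w 0)]
        exact h'
  · rintro ⟨c, rfl⟩
    simp [wedge]; ring

lemma crossRatio_mk {z w a b : Fin 2 → C} (hz : z ≠ 0) (hw : w ≠ 0) (ha : a ≠ 0) (hb : b ≠ 0) :
    crossRatio (Projectivization.mk C z hz) (Projectivization.mk C w hw)
      (Projectivization.mk C a ha) (Projectivization.mk C b hb) =
        wedge z a * wedge w b / (wedge z b * wedge w a) := by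
  obtain ⟨r, hr⟩ := Projectivization.exists_smul_eq_mk_rep C z hz
  obtain ⟨s, hs⟩ := Projectivization.exists_smul_eq_mk_rep C w hw
  obtain ⟨t, ht⟩ := Projectivization.exists_smul_eq_mk_rep C a ha
  obtain ⟨u, hu⟩ := Projectivization.exists_smul_eq_mk_rep C b hb
  change wedge _ _ * wedge _ _ / (wedge _ _ * wedge _ _) = _
  rw [← hr, ← hs, ← ht, ← hu]
  simp only [Units.smul_def, wedge_smul_left, wedge_smul_right]
  rw [show (t : C) * (r * wedge z a) * (u * (s * wedge w b)) =
      (r * s * t * u) * (wedge z a * wedge w b) by ring,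
    show (u : C) * (r * wedge z b) * (t * (s * wedge w a)) =
      (r * s * t * u) * (wedge z b * wedge w a) by ring]
  exact mul_div_mul_left _ _ (by simp)

lemma chordalDist_mk {v w : Fin 2 → C} (hv : v ≠ 0) (hw : w ≠ 0) :
    chordalDist (Projectivization.mk C v hv) (Projectivization.mk C w hw) =
      ‖wedge v w‖ / (‖v‖ * ‖w‖) := by
  obtain ⟨r, hr⟩ := Projectivization.exists_smul_eq_mk_rep C v hv
  obtain ⟨s, hs⟩ := Projectivization.exists_smul_eq_mk_rep C w hw
  change ‖wedge _ _‖ / _ = _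
  rw [← hr, ← hs]
  simp only [Units.smul_def, wedge_smul_left, wedge_smul_right, norm_smul, norm_mul]
  have h1 : ‖(r : C)‖ ≠ 0 := by simp
  have h2 : ‖(s : C)‖ ≠ 0 := by simp
  rw [show ‖(s : C)‖ * (‖(r : C)‖ * ‖wedge v w‖) = (‖(r : C)‖ * ‖(s : C)‖) * ‖wedge v w‖ by ring,
    show ‖(r : C)‖ * ‖v‖ * (‖(s : C)‖ * ‖w‖) = (‖(r : C)‖ * ‖(s : C)‖) * (‖v‖ * ‖w‖) by ring]
  exact mul_div_mul_left _ _ (mul_ne_zero h1 h2)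

lemma bracket_eq_zero_iff (x y : P1 C) : bracket x y = 0 ↔ x = y := by
  conv_rhs => rw [← x.mk_rep, ← y.mk_rep]
  exact wedge_eq_zero_iff x.rep_nonzero y.rep_nonzero

lemma chordalDist_nonneg (x y : P1 C) : 0 ≤ chordalDist x y := by
  unfold chordalDist
  positivity

lemma chordalDist_pos {x y : P1 C} (h : x ≠ y) : 0 < chordalDist x y := by
  have h1 := norm_pos_iff.2 ((bracket_eq_zero_iff x y).not.2 h)
  have h2 := norm_pos_iff.2 x.rep_nonzero
  have h3 := norm_pos_iff.2 y.rep_nonzero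
  unfold chordalDist
  positivity

lemma bracket_comm (x y : P1 C) : bracket x y = -bracket y x := wedge_comm _ _

lemma chordalDist_comm (x y : P1 C) : chordalDist x y = chordalDist y x := by
  rw [chordalDist, chordalDist, bracket_comm, norm_neg, mul_comm ‖x.rep‖]

/-- This is the Plücker relation; it shows that a factor of the product is close to 1 as soon as a
and b are close. -/
lemma crossRatio_sub_one {z w a b : P1 C} (hzb : z ≠ b) (hwa : w ≠ a) :
    crossRatio z w a b - 1 = bracket z w * bracket a b / (bracket z b * bracket w a) := by
  have h1 := (bracket_eq_zero_iff z b).not.2 hzb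
  have h2 := (bracket_eq_zero_iff w a).not.2 hwa
  rw [crossRatio, div_sub_one (mul_ne_zero h1 h2)]
  congr 1
  exact wedge_plucker _ _ _ _

lemma norm_crossRatio_sub_one {z w a b : P1 C} (hzb : z ≠ b) (hwa : w ≠ a) :
    ‖crossRatio z w a b - 1‖ =
      chordalDist z w * chordalDist a b / (chordalDist z b * chordalDist w a) := by
  rw [crossRatio_sub_one hzb hwa]
  have h1 := norm_ne_zero_iff.2 z.rep_nonzero
  have h2 := norm_ne_zero_iff.2 w.rep_nonzero
  have h3 := norm_ne_zero_iff.2 a.rep_nonzero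
  have h4 := norm_ne_zero_iff.2 b.rep_nonzero
  have h5 := norm_ne_zero_iff.2 ((bracket_eq_zero_iff z b).not.2 hzb)
  have h6 := norm_ne_zero_iff.2 ((bracket_eq_zero_iff w a).not.2 hwa)
  simp only [chordalDist, norm_div, norm_mul]
  field_simp

lemma crossRatio_ne_zero {z w a b : P1 C} (hza : z ≠ a) (hzb : z ≠ b) (hwa : w ≠ a) (hwb : w ≠ b) :
    crossRatio z w a b ≠ 0 := by
  simp [crossRatio, bracket_eq_zero_iff, *]

lemma crossRatio_symm (z w a b : P1 C) : crossRatio z w a b = crossRatio a b z w := by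
  simp only [crossRatio]
  rw [bracket_comm z a, bracket_comm w b, bracket_comm z b, bracket_comm w a]
  ring

lemma crossRatio_mul_left {z w v a b : P1 C} (hwa : w ≠ a) (hwb : w ≠ b) :
    crossRatio z w a b * crossRatio w v a b = crossRatio z v a b := by
  have h1 := (bracket_eq_zero_iff w a).not.2 hwa
  have h2 := (bracket_eq_zero_iff w b).not.2 hwb
  simp only [crossRatio]
  rw [div_mul_div_comm, show bracket z a * bracket w b * (bracket w a * bracket v b) =
      (bracket w a * bracket w b) * (bracket z a * bracket v b) by ring,
    show bracket z b * bracket w a * (bracket w b * bracket v a) =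
      (bracket w a * bracket w b) * (bracket z b * bracket v a) by ring]
  exact mul_div_mul_left _ _ (mul_ne_zero h1 h2)

end Vectors

/-! ### Möbius action in homogeneous coordinates. -/

section Action

variable {K : Type*} [NontriviallyNormedField K] {C : Type*} [NormedField C] [NormedAlgebra K C]

/-- The action of a matrix over `K` on vectors over `C`. -/
def mv (M : Matrix (Fin 2) (Fin 2) K) (v : Fin 2 → C) : Fin 2 → C :=
  fun i => algebraMap K C (M i 0) * v 0 + algebraMap K C (M i 1) * v 1

lemma wedge_mv (M : Matrix (Fin 2) (Fin 2) K) (v w : Fin 2 → C) :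
    wedge (mv M v) (mv M w) = algebraMap K C M.det * wedge v w := by
  simp only [wedge, mv, Matrix.det_fin_two, map_sub, map_mul]
  ring

lemma mv_mul (M N : Matrix (Fin 2) (Fin 2) K) (v : Fin 2 → C) : mv (M * N) v = mv M (mv N v) := by
  ext i
  simp only [mv, Matrix.mul_apply, Fin.sum_univ_two, map_add, map_mul]
  ring

lemma mv_one (v : Fin 2 → C) : mv (1 : Matrix (Fin 2) (Fin 2) K) v = v := by
  funext i
  fin_cases i
  · change algebraMap K C ((1 : Matrix (Fin 2) (Fin 2) K) 0 0) * v 0 +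
      algebraMap K C ((1 : Matrix (Fin 2) (Fin 2) K) 0 1) * v 1 = v 0
    simp
  · change algebraMap K C ((1 : Matrix (Fin 2) (Fin 2) K) 1 0) * v 0 +
      algebraMap K C ((1 : Matrix (Fin 2) (Fin 2) K) 1 1) * v 1 = v 1
    simp

lemma continuous_mv (v : Fin 2 → C) :
    Continuous (fun M : Matrix (Fin 2) (Fin 2) K => mv M v) := by
  have := continuous_algebraMap K C
  unfold mv
  fun_prop

lemma mv_ne_zero (G : GL (Fin 2) K) {v : Fin 2 → C} (hv : v ≠ 0) : mv G.val v ≠ 0 := fun h => by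
  apply hv
  have h1 : mv (G⁻¹.val * G.val) v = v := by rw [← Units.val_mul, inv_mul_cancel]; exact mv_one v
  rw [← h1, mv_mul, h]
  ext i
  simp [mv]

lemma act_mk (G : GL (Fin 2) K) {v : Fin 2 → C} (hv : v ≠ 0) :
    act (ProjGenLinGroup.mk G) (Projectivization.mk C v hv) =
      Projectivization.mk C (mv G.val v) (mv_ne_zero G hv) := by
  unfold act
  rw [ProjGenLinGroup.map_mk, Projectivization.PGL.mk_smul_mk]
  congr 1
  ext i
  change ((GeneralLinearGroup.map (algebraMap K C) G).val *ᵥ v) i = _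
  simp [mv, Matrix.mulVec, dotProduct, Fin.sum_univ_two]

lemma act_lift (g : PGL(2, K)) {v : Fin 2 → C} (hv : v ≠ 0) :
    act g (Projectivization.mk C v hv) =
      Projectivization.mk C (mv (lift g).val v) (mv_ne_zero _ hv) := by
  rw [← act_mk, mk_lift]

lemma act_mul (g h : PGL(2, K)) (x : P1 C) : act (g * h) x = act g (act h x) := by
  simp [act, mul_smul]

lemma act_one (x : P1 C) : act (1 : PGL(2, K)) x = x := by simp [act]

lemma crossRatio_act (g : PGL(2, K)) (z w a b : P1 C) :
    crossRatio (act g z) (act g w) (act g a) (act g b) = crossRatio z w a b := by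
  induction z using Projectivization.ind with | _ z hz
  induction w using Projectivization.ind with | _ w hw
  induction a using Projectivization.ind with | _ a ha
  induction b using Projectivization.ind with | _ b hb
  have hd : algebraMap K C (lift g).val.det ≠ 0 := by simpa using det_ne_zero (lift g)
  simp only [act_lift, crossRatio_mk, wedge_mv]
  generalize algebraMap K C (lift g).val.det = d at *
  rw [show d * wedge z a * (d * wedge w b) = (d * d) * (wedge z a * wedge w b) by ring,
    show d * wedge z b * (d * wedge w a) = (d * d) * (wedge z b * wedge w a) by ring]
  exact mul_div_mul_left _ _ (mul_ne_zero hd hd)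

end Action

end

section

/-! ### Unconditional convergence of ultrametric products. -/

section Products

variable {C : Type*} [NormedField C] [IsUltrametricDist C]

lemma norm_prod_sub_one_lt {ι : Type*} (s : Finset ι) (f : ι → C) {r : ℝ} (hr : 0 < r)
    (hr1 : r ≤ 1) (h : ∀ i ∈ s, ‖f i - 1‖ < r) : ‖∏ i ∈ s, f i - 1‖ < r := by
  classical
  induction s using Finset.induction_on with
  | empty => simpa
  | insert a s has ih =>
    rw [Finset.prod_insert has]
    have h1 := h a (Finset.mem_insert_self _ _)
    have h2 := ih fun i hi => h i (Finset.mem_insert_of_mem hi)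
    have h3 : ‖f a‖ ≤ 1 := by
      rw [← sub_add_cancel (f a) 1]
      refine (IsUltrametricDist.norm_add_le_max _ _).trans (max_le (h1.le.trans hr1) ?_)
      simp
    rw [show f a * ∏ i ∈ s, f i - 1 = f a * (∏ i ∈ s, f i - 1) + (f a - 1) by ring]
    refine (IsUltrametricDist.norm_add_le_max _ _).trans_lt (max_lt ?_ h1)
    rw [norm_mul]
    exact (mul_le_of_le_one_left (norm_nonneg _) h3).trans_lt h2

/-- In a complete ultrametric field a product converges unconditionally as soon as its factors
tend to `1`. -/
lemma multipliable_of_tendsto_norm_sub_one [CompleteSpace C] {ι : Type*} {f : ι → C}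
    (h : Tendsto (fun i => ‖f i - 1‖) cofinite (𝓝 0)) : Multipliable f := by
  classical
  have key : ∀ r : ℝ, 0 < r → {i | r ≤ ‖f i - 1‖}.Finite := fun r hr => by
    have := h.eventually (gt_mem_nhds hr)
    simpa [Filter.eventually_cofinite] using this
  have hf : ∀ i, ‖f i - 1‖ < 1 → ‖f i‖ ≤ 1 := fun i hi => by
    rw [← sub_add_cancel (f i) 1]
    exact (IsUltrametricDist.norm_add_le_max _ _).trans (max_le hi.le (by simp))
  -- Only the finitely many factors in S can have norm above 1, so B bounds every partial product.
  set S := (key 1 one_pos).toFinset with hS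
  set B := ∏ i ∈ S, max 1 ‖f i‖ with hB
  have hB1 : 1 ≤ B := Finset.one_le_prod fun i _ => le_max_left _ _
  have hbound : ∀ s : Finset ι, ‖∏ i ∈ s, f i‖ ≤ B := fun s => by
    rw [norm_prod]
    calc ∏ i ∈ s, ‖f i‖ ≤ ∏ i ∈ s, (if i ∈ S then max 1 ‖f i‖ else 1) := by
          refine Finset.prod_le_prod (fun i _ => norm_nonneg _) fun i _ => ?_
          split_ifs with hi
          · exact le_max_right _ _
          · exact hf i (by simpa [hS] using hi)
      _ = ∏ i ∈ s ∩ S, max 1 ‖f i‖ := by rw [← Finset.prod_ite_mem]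
      _ ≤ B := Finset.prod_le_prod_of_subset_of_one_le Finset.inter_subset_right
          (fun i _ => by positivity) fun i _ _ => le_max_left _ _
  refine CompleteSpace.complete (Metric.cauchySeq_iff'.2 fun ε hε => ?_ :
    CauchySeq fun s : Finset ι => ∏ i ∈ s, f i)
  -- The cap at 1 is required by `norm_prod_sub_one_lt`; the other bound makes r * B at most ε / 2.
  set r := min 1 (ε / (2 * B)) with hr
  have hr0 : 0 < r := by positivity
  refine ⟨(key r hr0).toFinset, fun s hs => ?_⟩
  set N := (key r hr0).toFinset
  rw [dist_eq_norm, ← Finset.prod_sdiff hs, show (∏ i ∈ s \ N, f i) * ∏ i ∈ N, f i - ∏ i ∈ N, f i =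
    (∏ i ∈ s \ N, f i - 1) * ∏ i ∈ N, f i by ring, norm_mul]
  have h1 := norm_prod_sub_one_lt (s \ N) f hr0 (min_le_left _ _) fun i hi => by
    simpa [N] using (Finset.mem_sdiff.1 hi).2
  calc _ ≤ r * B := mul_le_mul h1.le (hbound N) (norm_nonneg _) hr0.le
    _ ≤ ε / (2 * B) * B := by gcongr; exact min_le_right _ _
    _ = ε / 2 := by field_simp
    _ < ε := half_lt_self hε

end Products

/-- Without a lower bound the infimum 0 is not attained, so some strictly decreasing sequence of
values tends to 0. This turns the sequential definition of limit points into uniform estimates. -/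
lemma exists_pos_le_of_forall_injective {ι : Type*} {f : ι → ℝ} (hf : ∀ i, 0 < f i)
    (h : ∀ u : ℕ → ι, Function.Injective u → ¬ Tendsto (fun n => f (u n)) atTop (𝓝 0)) :
    ∃ c > 0, ∀ i, c ≤ f i := by
  by_contra! H
  have hne : (Set.range f).Nonempty := by
    obtain ⟨i, -⟩ := H 1 one_pos
    exact ⟨_, i, rfl⟩
  have hglb : IsGLB (Set.range f) 0 := by
    refine ⟨?_, fun b hb => ?_⟩
    · rintro _ ⟨i, rfl⟩
      exact (hf i).le
    · by_contra! hb0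
      obtain ⟨i, hi⟩ := H b hb0
      exact absurd (hb ⟨i, rfl⟩) (not_le.2 hi)
  obtain ⟨u, hu, -, hlim, hmem⟩ := hglb.exists_seq_strictAnti_tendsto_of_notMem
    (by rintro ⟨i, hi⟩; exact (hf i).ne' hi) hne
  choose v hv using hmem
  refine h v (fun m n hmn => hu.injective ?_) (by simpa [hv] using hlim)
  rw [← hv, ← hv, hmn]

/-! ### Consequences of discreteness. -/

section Discrete

variable {K : Type*} [NontriviallyNormedField K] 

lemma exists_subseq_lift [ProperSpace K] (γ : ℕ → PGL(2, K)) :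
    ∃ (M : Matrix (Fin 2) (Fin 2) K) (φ : ℕ → ℕ), StrictMono φ ∧ entryNorm M = 1 ∧
      Tendsto (fun n => (lift (γ (φ n))).val) atTop (𝓝 M) := by
  have hb : ∀ n, (fun i j => (lift (γ n)).val i j : Fin 2 → Fin 2 → K) ∈
      Metric.closedBall (0 : Fin 2 → Fin 2 → K) 1 := fun n => by
    rw [mem_closedBall_zero_iff, pi_norm_le_iff_of_nonneg zero_le_one]
    intro i
    rw [pi_norm_le_iff_of_nonneg zero_le_one]
    intro j
    exact (norm_le_entryNorm _ i j).trans_eq (entryNorm_lift _)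
  obtain ⟨M, -, φ, hφ, hM⟩ := tendsto_subseq_of_bounded Metric.isBounded_closedBall hb
  refine ⟨M, φ, hφ, ?_, hM⟩
  have h1 := (continuous_entryNorm.tendsto M).comp hM
  refine tendsto_nhds_unique h1 ?_
  refine tendsto_const_nhds.congr fun n => ?_
  exact (entryNorm_lift (γ (φ n))).symm

lemma tendsto_inv_mul_nhds_one {G : ℕ → GL (Fin 2) K} {M : Matrix (Fin 2) (Fin 2) K}
    (hG : Tendsto (fun n => (G n).val) atTop (𝓝 M)) (hM : M.det ≠ 0) :
    Tendsto (fun n => (G (n + 1))⁻¹ * G n) atTop (𝓝 1) := by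
  have key : ∀ φ ψ : ℕ → ℕ, Tendsto φ atTop atTop → Tendsto ψ atTop atTop →
      Tendsto (fun n => ((G (φ n))⁻¹ * G (ψ n)).val) atTop (𝓝 1) := by
    intro φ ψ hφ hψ
    have h1 := hG.comp hφ
    have h2 := hG.comp hψ
    have h3 : Tendsto (fun n => (G (φ n)).val.det⁻¹ • ((G (φ n)).val.adjugate * (G (ψ n)).val))
        atTop (𝓝 (M.det⁻¹ • (M.adjugate * M))) := by
      refine Tendsto.smul ?_ ?_
      · exact ((continuous_id.matrix_det.tendsto M).comp h1).inv₀ hM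
      · have h4 : Tendsto (fun n => (G (φ n)).val.adjugate) atTop (𝓝 M.adjugate) :=
          (continuous_id.matrix_adjugate.tendsto M).comp h1
        exact h4.mul h2
    rw [Matrix.adjugate_mul, smul_smul, inv_mul_cancel₀ hM, one_smul] at h3
    refine h3.congr fun n => ?_
    rw [Units.val_mul, Matrix.coe_units_inv, Matrix.inv_def, Ring.inverse_eq_inv',
      Matrix.smul_mul]
  -- Convergence in the unit group requires convergence of the inverses as well.
  rw [Units.isInducing_embedProduct.tendsto_nhds_iff]
  refine Tendsto.prodMk_nhds ?_ ?_
  · exact key (· + 1) id (tendsto_add_atTop_nat 1) tendsto_id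
  · refine (MulOpposite.continuous_op.tendsto _).comp ?_
    refine (key id (· + 1) tendsto_id (tendsto_add_atTop_nat 1)).congr fun n => ?_
    simp [_root_.mul_inv_rev]

variable {Γ : Subgroup PGL(2, K)}

/-- If the limit were invertible, the quotients of consecutive terms would tend to 1, hence be equal
to 1 eventually by discreteness. -/
lemma det_eq_zero_of_tendsto_lift (hΓ : IsSchottky Γ) {γ : ℕ → Γ} (hγ : Function.Injective γ)
    {M : Matrix (Fin 2) (Fin 2) K}
    (hM : Tendsto (fun n => (lift (γ n : PGL(2, K))).val) atTop (𝓝 M)) : M.det = 0 := by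
  by_contra h0
  have h1 := tendsto_inv_mul_nhds_one hM h0
  have hc : Continuous (ProjGenLinGroup.mk : GL (Fin 2) K →* PGL(2, K)) := continuous_coinduced_rng
  have h2 := (hc.tendsto 1).comp h1
  have h3 : Tendsto (fun n => (γ (n + 1))⁻¹ * γ n) atTop (𝓝 (1 : Γ)) := by
    rw [tendsto_subtype_rng]
    refine h2.congr fun n => ?_
    simp
  have := hΓ.discrete
  rw [nhds_discrete, tendsto_pure] at h3
  obtain ⟨n, hn⟩ := h3.exists
  have := hγ (inv_mul_eq_one.1 hn)
  omega

lemma exists_subseq_lift_det_eq_zero [ProperSpace K] (hΓ : IsSchottky Γ) {γ : ℕ → Γ}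
    (hγ : Function.Injective γ) :
    ∃ (M : Matrix (Fin 2) (Fin 2) K) (φ : ℕ → ℕ), StrictMono φ ∧ entryNorm M = 1 ∧ M.det = 0 ∧
      Tendsto (fun n => (lift (γ (φ n) : PGL(2, K))).val) atTop (𝓝 M) := by
  obtain ⟨M, φ, hφ, hM, hlim⟩ := exists_subseq_lift fun n => (γ n : PGL(2, K))
  exact ⟨M, φ, hφ, hM, det_eq_zero_of_tendsto_lift hΓ (hγ.comp hφ.injective) hlim, hlim⟩

/-- A bound on `rho` keeps the determinants of the normalised lifts away from 0, whereas along a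
subsequence of distinct elements they tend to 0. -/
lemma finite_rho_le [ProperSpace K] (hΓ : IsSchottky Γ) (R : ℝ) :
    {γ : Γ | rho (γ : PGL(2, K)) ≤ R}.Finite := by
  by_contra hinf
  have hinf : {γ : Γ | rho (γ : PGL(2, K)) ≤ R}.Infinite := hinf
  set γ := hinf.natEmbedding
  obtain ⟨M, φ, -, -, hdet, hlim⟩ := exists_subseq_lift_det_eq_zero hΓ
    (γ := fun n => (γ n : Γ)) (Subtype.val_injective.comp γ.injective)
  have h1 := ((continuous_id.matrix_det.tendsto M).comp hlim).norm
  simp only [id, hdet, norm_zero] at h1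
  have hR : 0 < R := (rho_pos _).trans_le (γ 0).2
  obtain ⟨n, hn⟩ := (h1.eventually (gt_mem_nhds (inv_pos.2 hR))).exists
  have h2 : rho ((γ (φ n) : Γ) : PGL(2, K)) ≤ R := (γ (φ n)).2
  rw [rho, inv_le_comm₀ (norm_pos_iff.2 (det_ne_zero _)) hR] at h2
  exact absurd hn (not_lt.2 h2)

lemma tendsto_inv_rho [ProperSpace K] (hΓ : IsSchottky Γ) :
    Tendsto (fun γ : Γ => (rho (γ : PGL(2, K)))⁻¹) cofinite (𝓝 0) := by
  rw [Metric.tendsto_nhds]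
  intro ε hε
  rw [Filter.eventually_cofinite]
  refine (finite_rho_le hΓ ε⁻¹).subset fun γ hγ => ?_
  have h0 := rho_pos (γ : PGL(2, K))
  have : ¬ (rho (γ : PGL(2, K)))⁻¹ < ε := by
    simpa [Real.dist_eq, abs_of_pos h0] using hγ
  exact (le_inv_comm₀ hε h0).1 (not_lt.1 this)

lemma countable_of_isSchottky [ProperSpace K] (hΓ : IsSchottky Γ) : Countable Γ := by
  rw [← Set.countable_univ_iff]
  refine (Set.countable_iUnion fun n : ℕ => (finite_rho_le hΓ n).countable).mono fun γ _ => ?_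
  obtain ⟨n, hn⟩ := exists_nat_ge (rho (γ : PGL(2, K)))
  exact Set.mem_iUnion.2 ⟨n, hn⟩

/-- A Schottky group acts freely on the vertices of the Bruhat-Tits tree. -/
lemma eq_one_of_conj_mem_vertexStab [IsUltrametricDist K] [ProperSpace K] (hΓ : IsSchottky Γ)
    {γ : Γ} {g : PGL(2, K)} (h : g⁻¹ * γ * g ∈ vertexStab K) : γ = 1 := by
  have hfin : IsOfFinOrder γ := by
    rw [← finite_powers]
    -- All powers of γ fix the vertex g, so they displace the standard vertex by a bounded amount.
    refine (finite_rho_le hΓ (rho g * rho g)).subset ?_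
    rintro _ ⟨n, rfl⟩
    have h1 : g⁻¹ * (γ : PGL(2, K)) ^ n * g ∈ vertexStab K := by
      rw [show g⁻¹ * (γ : PGL(2, K)) ^ n * g = (g⁻¹ * γ * g) ^ n by
        simpa using (conj_pow (a := g⁻¹) (b := (γ : PGL(2, K))) (i := n)).symm]
      exact pow_mem h n
    have h2 : ((γ ^ n : Γ) : PGL(2, K)) = g * (g⁻¹ * (γ : PGL(2, K)) ^ n * g) * g⁻¹ := by
      rw [Subgroup.coe_pow]
      group
    have h3 := rho_mul_le (g * (g⁻¹ * (γ : PGL(2, K)) ^ n * g)) g⁻¹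
    rwa [← h2, rho_mul_right h1, rho_inv] at h3
  have := hΓ.torsionFree γ γ.2 (Submonoid.isOfFinOrder_coe.2 hfin)
  exact_mod_cast this

end Discrete

end

/-! ### Ordinary points. -/

section

variable {K : Type*} [NontriviallyNormedField K]
  {C : Type*} [NormedField C] [NormedAlgebra K C]

lemma mv_smul_left (c : K) (M : Matrix (Fin 2) (Fin 2) K) (v : Fin 2 → C) :
    mv (c • M) v = algebraMap K C c • mv M v := by
  ext i
  simp only [mv, Matrix.smul_apply, smul_eq_mul, map_mul, Pi.smul_apply]
  ring

/-- Both matrices represent g and have largest entry of norm 1, so they differ by a scalar of norm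
1. -/
lemma norm_mv_adjugate_lift_inv (g : PGL(2, K)) (v : Fin 2 → C) :
    ‖mv (lift g⁻¹).val.adjugate v‖ = ‖mv (lift g).val v‖ := by
  obtain ⟨u, hu⟩ := ProjGenLinGroup.mk_eq_mk_iff.1
    (show ProjGenLinGroup.mk (lift g⁻¹)⁻¹ = ProjGenLinGroup.mk (lift g) by simp)
  set A := (lift g⁻¹).val with hA
  have h1 : (lift g).val = ((u : K) * A.det⁻¹) • A.adjugate := by
    rw [← hu, val_scalar_mul, Matrix.coe_units_inv, Matrix.inv_def, Ring.inverse_eq_inv', smul_smul]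
  have h2 : ‖(u : K) * A.det⁻¹‖ = 1 := by
    have := congrArg entryNorm h1
    rw [entryNorm_lift, entryNorm_smul, entryNorm_adjugate, entryNorm_lift, mul_one] at this
    exact this.symm
  rw [h1, mv_smul_left, norm_smul, norm_algebraMap', h2, one_mul]

lemma wedge_eq_zero_of_mv_eq_zero {M : Matrix (Fin 2) (Fin 2) K} (hM : M ≠ 0) {u v : Fin 2 → C}
    (hu : mv M u = 0) (hv : mv M v = 0) : wedge u v = 0 := by
  by_contra h
  apply hM
  ext i j
  have h1 : algebraMap K C (M i 0) * u 0 + algebraMap K C (M i 1) * u 1 = 0 := congrFun hu i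
  have h2 : algebraMap K C (M i 0) * v 0 + algebraMap K C (M i 1) * v 1 = 0 := congrFun hv i
  have h3 : algebraMap K C (M i 0) * wedge u v = 0 := by
    rw [wedge]; linear_combination v 1 * h1 - u 1 * h2
  have h4 : algebraMap K C (M i 1) * wedge u v = 0 := by
    rw [wedge]; linear_combination u 0 * h2 - v 0 * h1
  have h5 : M i 0 = 0 := by simpa [h] using h3
  have h6 : M i 1 = 0 := by simpa [h] using h4
  fin_cases j
  exacts [h5, h6]

lemma exists_mv_ne_zero {M : Matrix (Fin 2) (Fin 2) K} (hM : M ≠ 0) :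
    ∃ e : Fin 2 → C, mv M e ≠ 0 := by
  by_contra! h
  have := wedge_eq_zero_of_mv_eq_zero hM (h ![1, 0]) (h ![0, 1])
  simp [wedge] at this

lemma norm_mv_le [IsUltrametricDist C] (M : Matrix (Fin 2) (Fin 2) K) (v : Fin 2 → C) :
    ‖mv M v‖ ≤ entryNorm M * ‖v‖ := by
  rw [pi_norm_le_iff_of_nonneg (mul_nonneg (entryNorm_nonneg _) (norm_nonneg _))]
  intro i
  exact norm_add_mul_le ((norm_algebraMap' C _).trans_le (norm_le_entryNorm _ _ _))
    ((norm_algebraMap' C _).trans_le (norm_le_entryNorm _ _ _)) (norm_le_pi_norm _ _)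
    (norm_le_pi_norm _ _)

lemma chordalDist_act_mk (g : PGL(2, K)) {u v : Fin 2 → C} (hu : u ≠ 0) (hv : v ≠ 0) :
    chordalDist (act g (Projectivization.mk C u hu)) (act g (Projectivization.mk C v hv)) =
      (rho g)⁻¹ * ‖wedge u v‖ / (‖mv (lift g).val u‖ * ‖mv (lift g).val v‖) := by
  rw [act_lift, act_lift, chordalDist_mk, wedge_mv, norm_mul, norm_algebraMap', rho, inv_inv]

/-- The adjugate does not increase norms and composes with the lift to the determinant, of norm 1 /
`rho g`. -/
lemma inv_rho_mul_norm_le [IsUltrametricDist C] (g : PGL(2, K)) (v : Fin 2 → C) :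
    (rho g)⁻¹ * ‖v‖ ≤ ‖mv (lift g).val v‖ := by
  have h1 : mv ((lift g).val.adjugate * (lift g).val) v = algebraMap K C (lift g).val.det • v := by
    rw [Matrix.adjugate_mul, mv_smul_left, mv_one]
  have h2 := norm_mv_le (lift g).val.adjugate (mv (lift g).val v)
  rwa [← mv_mul, h1, norm_smul, norm_algebraMap', entryNorm_adjugate, entryNorm_lift, one_mul,
    ← inv_inv ‖_‖] at h2

lemma chordalDist_act_le [IsUltrametricDist C] (g : PGL(2, K)) (x y : P1 C) :
    chordalDist (act g x) (act g y) ≤ rho g * chordalDist x y := by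
  induction x using Projectivization.ind with | _ u hu
  induction y using Projectivization.ind with | _ v hv
  have h0 := rho_pos g
  have h1 := inv_rho_mul_norm_le g u
  have h2 := inv_rho_mul_norm_le g v
  have h3 := norm_pos_iff.2 hu
  have h4 := norm_pos_iff.2 hv
  rw [chordalDist_act_mk, chordalDist_mk]
  calc _ ≤ (rho g)⁻¹ * ‖wedge u v‖ / (((rho g)⁻¹ * ‖u‖) * ((rho g)⁻¹ * ‖v‖)) := by gcongr
    _ = _ := by field_simp

variable {Γ : Subgroup PGL(2, K)}

/-- The action of α⁻¹ is Lipschitz for the chordal metric, so it carries a sequence converging to αx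
to one converging to x. -/
lemma act_mem_ordinarySet [IsUltrametricDist C] {x : P1 C} (hx : x ∈ ordinarySet C Γ) (α : Γ) :
    act (α : PGL(2, K)) x ∈ ordinarySet C Γ := by
  rintro ⟨q, γ, hγ, hlim⟩
  refine hx ⟨q, fun n => α⁻¹ * γ n, fun m n h => hγ (mul_left_cancel h), ?_⟩
  have h1 := hlim.const_mul (rho ((α : PGL(2, K))⁻¹))
  rw [mul_zero] at h1
  refine squeeze_zero (fun n => chordalDist_nonneg _ _) (fun n => ?_) h1
  have := chordalDist_act_le (α : PGL(2, K))⁻¹ (act (γ n : PGL(2, K)) q) (act (α : PGL(2, K)) x)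
  rwa [← act_mul, ← act_mul, inv_mul_cancel, act_one] at this

/-- Elements of a Schottky group do not contract the lines of ordinary points. -/
lemma exists_le_norm_mv_lift [ProperSpace K] (hΓ : IsSchottky Γ) {v : Fin 2 → C} (hv : v ≠ 0)
    (hx : Projectivization.mk C v hv ∈ ordinarySet C Γ) :
    ∃ c > 0, ∀ γ : Γ, c ≤ ‖mv (lift (γ : PGL(2, K))).val v‖ := by
  refine exists_pos_le_of_forall_injective (fun γ => norm_pos_iff.2 (mv_ne_zero _ hv)) ?_
  intro γ hγ hlim
  -- If the γₙ contract v, the limit M of the lifts of their inverses satisfies adj(M) v = 0. As M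
  -- has rank one, v spans its image, so γₙ⁻¹ e tends to [v] along a subsequence whenever M e ≠ 0,
  -- and [v] is a limit point.
  obtain ⟨M, φ, hφ, hM1, hM0, hM⟩ := exists_subseq_lift_det_eq_zero hΓ
    (γ := fun n => (γ n)⁻¹) (inv_injective.comp hγ)
  have hne : M ≠ 0 := by
    rintro rfl
    simp [entryNorm] at hM1
  have hne' : M.adjugate ≠ 0 := by
    intro h
    have := entryNorm_adjugate M
    rw [h, hM1] at this
    simp [entryNorm] at this
  have h1 : mv M.adjugate v = 0 := by
    have h2 : Tendsto (fun n => mv (lift ((γ (φ n))⁻¹ : PGL(2, K))).val.adjugate v) atTop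
        (𝓝 (mv M.adjugate v)) :=
      (((continuous_mv v).comp continuous_id.matrix_adjugate).tendsto M).comp hM
    have h3 := hlim.comp hφ.tendsto_atTop
    rw [← norm_eq_zero]
    refine tendsto_nhds_unique h2.norm (h3.congr fun n => ?_)
    exact (norm_mv_adjugate_lift_inv _ v).symm
  obtain ⟨e, he⟩ := exists_mv_ne_zero (C := C) hne
  have he0 : e ≠ 0 := by
    rintro rfl
    exact he (by ext i; simp [mv])
  have h4 : mv M.adjugate (mv M e) = 0 := by
    rw [← mv_mul, Matrix.adjugate_mul, hM0, mv_smul_left]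
    simp
  refine hx ⟨Projectivization.mk C e he0, fun n => (γ (φ n))⁻¹,
    inv_injective.comp (hγ.comp hφ.injective), ?_⟩
  have h5 : Tendsto (fun n => mv (lift ((γ (φ n))⁻¹ : PGL(2, K))).val e) atTop (𝓝 (mv M e)) :=
    ((continuous_mv e).tendsto M).comp hM
  have h6 : Continuous (fun u : Fin 2 → C => wedge u v) := by unfold wedge; fun_prop
  have h7 := ((h6.tendsto _).comp h5).norm.div (h5.norm.mul_const ‖v‖)
    (mul_ne_zero (norm_ne_zero_iff.2 he) (norm_ne_zero_iff.2 hv))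
  rw [wedge_eq_zero_of_mv_eq_zero hne' h4 h1, norm_zero, zero_div] at h7
  refine h7.congr fun n => ?_
  simp only [InvMemClass.coe_inv, act_lift, chordalDist_mk]
  rfl

/-- The point `[s : 1]` of the projective line. -/
def affinePt (s : C) : P1 C := Projectivization.mk C ![s, 1] (by simp)

lemma affinePt_injective : Function.Injective (affinePt : C → P1 C) := fun s t h => by
  have := (wedge_eq_zero_iff (C := C) _ _).2 h
  simpa [wedge, sub_eq_zero] using this

/-- The K-linear map k ↦ k₀ - k₁ s is injective because s is not in K, and an injective linear map
on a finite-dimensional space over a complete field is bounded below. -/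
lemma exists_mul_norm_le [ProperSpace K] {s : C} (hs : s ∉ Set.range (algebraMap K C)) :
    ∃ c > 0, ∀ k : Fin 2 → K,
      c * ‖k‖ ≤ ‖wedge (fun i => algebraMap K C (k i)) ![s, 1]‖ := by
  have : CompleteSpace K := inferInstance
  let f : (Fin 2 → K) →ₗ[K] C :=
    { toFun := fun k => wedge (fun i => algebraMap K C (k i)) ![s, 1]
      map_add' := fun k l => by simp [wedge]; ring
      map_smul' := fun c k => by simp [wedge, Algebra.smul_def]; ring }
  have hf : LinearMap.ker f = ⊥ := by
    rw [LinearMap.ker_eq_bot']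
    intro k hk
    have hk' : algebraMap K C (k 0) = algebraMap K C (k 1) * s := by
      simpa [f, wedge, sub_eq_zero] using hk
    have h1 : k 1 = 0 := by
      by_contra h1
      refine hs ⟨k 0 / k 1, ?_⟩
      have : algebraMap K C (k 1) ≠ 0 := by simpa using h1
      rw [map_div₀, hk']
      field_simp
    have h0 : k 0 = 0 := by simpa [h1] using hk'
    ext i
    fin_cases i <;> simp [h0, h1]
  obtain ⟨c, hc, h⟩ := f.exists_antilipschitzWith hf
  refine ⟨(c : ℝ)⁻¹, by positivity, fun k => ?_⟩
  have h1 := h.le_mul_dist k 0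
  rw [map_zero, dist_zero_right, dist_zero_right] at h1
  rw [inv_mul_le_iff₀ (by positivity)]
  exact h1

/-- Points of the projective line that are not rational over `K` are ordinary. -/
lemma affinePt_mem_ordinarySet [ProperSpace K] (hΓ : IsSchottky Γ) {s : C}
    (hs : s ∉ Set.range (algebraMap K C)) : affinePt s ∈ ordinarySet C Γ := by
  rintro ⟨q, γ, hγ, hlim⟩
  obtain ⟨M, φ, hφ, hM1, hM0, hM⟩ := exists_subseq_lift_det_eq_zero hΓ hγ
  have hne : M ≠ 0 := by
    rintro rfl
    simp [entryNorm] at hM1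
  obtain ⟨c, hc, hcs⟩ := exists_mul_norm_le hs
  have hs1 : (![s, 1] : Fin 2 → C) ≠ 0 := by simp
  have hs0 : 0 < ‖(![s, 1] : Fin 2 → C)‖ := norm_pos_iff.2 hs1
  have hlim := hlim.comp hφ.tendsto_atTop
  induction q using Projectivization.ind with | _ v hv
  by_cases hMv : mv M v = 0
  · -- `v` is proportional to a vector `k` with coordinates in `K`
    obtain ⟨k, hk, hkM⟩ : ∃ k : Fin 2 → K, k ≠ 0 ∧ ∀ i, M i 0 * k 0 + M i 1 * k 1 = 0 := by
      obtain ⟨k, hk, h⟩ := Matrix.exists_mulVec_eq_zero_iff.2 hM0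
      refine ⟨k, hk, fun i => ?_⟩
      simpa [Matrix.mulVec, dotProduct, Fin.sum_univ_two] using congrFun h i
    set k' : Fin 2 → C := fun i => algebraMap K C (k i) with hk'
    have hk'0 : k' ≠ 0 := fun h => hk (by
      ext i
      simpa [hk'] using congrFun h i)
    have hkv : mv M k' = 0 := by
      ext i
      simp [mv, hk', ← map_mul, ← map_add, hkM]
    rw [(wedge_eq_zero_iff hv hk'0).1 (wedge_eq_zero_of_mv_eq_zero hne hMv hkv)] at hlim
    -- All translates of [k] are rational over K, so they stay at a definite distance from [s : 1].
    have hlow : ∀ g : PGL(2, K), c / ‖(![s, 1] : Fin 2 → C)‖ ≤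
        chordalDist (act g (Projectivization.mk C k' hk'0)) (affinePt s) := fun g => by
      have h1 : mv (lift g).val k' = fun i => algebraMap K C (((lift g).val *ᵥ k) i) := by
        ext i
        simp [mv, hk', Matrix.mulVec, dotProduct, Fin.sum_univ_two]
      have h2 := hcs ((lift g).val *ᵥ k)
      rw [← h1] at h2
      have h3 : ‖mv (lift g).val k'‖ = ‖(lift g).val *ᵥ k‖ := by
        rw [h1]
        simp [Pi.norm_def, nnnorm_algebraMap']
      have h4 : 0 < ‖(lift g).val *ᵥ k‖ := by
        rw [← h3]
        exact norm_pos_iff.2 (mv_ne_zero _ hk'0)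
      rw [act_lift, affinePt, chordalDist_mk, h3, div_le_div_iff₀ hs0 (by positivity)]
      calc _ = c * ‖(lift g).val *ᵥ k‖ * ‖(![s, 1] : Fin 2 → C)‖ := by ring
        _ ≤ _ := by gcongr
    have := ge_of_tendsto' hlim fun n => hlow _
    exact absurd this (not_le.2 (by positivity))
  -- Here the translates tend to [M v], which is rational over K because it is the image line of a
  -- rank-one matrix over K.
  · have h5 : Tendsto (fun n => mv (lift (γ (φ n) : PGL(2, K))).val v) atTop (𝓝 (mv M v)) :=
      ((continuous_mv v).tendsto M).comp hM
    have h6 : Continuous (fun u : Fin 2 → C => wedge u ![s, 1]) := by unfold wedge; fun_prop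
    have h7 := ((h6.tendsto _).comp h5).norm.div (h5.norm.mul_const ‖(![s, 1] : Fin 2 → C)‖)
      (mul_ne_zero (norm_ne_zero_iff.2 hMv) hs0.ne')
    have h8 : Tendsto (fun n => ‖wedge (mv (lift (γ (φ n) : PGL(2, K))).val v) ![s, 1]‖ /
        (‖mv (lift (γ (φ n) : PGL(2, K))).val v‖ * ‖(![s, 1] : Fin 2 → C)‖)) atTop (𝓝 0) := by
      refine hlim.congr fun n => ?_
      simp only [Function.comp, act_lift, affinePt, chordalDist_mk]
    have h9 := tendsto_nhds_unique h7 h8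
    have h10 : wedge (mv M v) ![s, 1] = 0 := by
      have hp : ‖mv M v‖ * ‖(![s, 1] : Fin 2 → C)‖ ≠ 0 :=
        mul_ne_zero (norm_ne_zero_iff.2 hMv) hs0.ne'
      simpa [hp] using (div_eq_zero_iff.1 h9).resolve_right hp
    obtain ⟨r, hr, hrM⟩ := Matrix.exists_vecMul_eq_zero_iff.2 hM0
    have h11 : ∀ j, r 0 * M 0 j + r 1 * M 1 j = 0 := fun j => by
      simpa [Matrix.vecMul, dotProduct, Fin.sum_univ_two] using congrFun hrM j
    have h12 : mv M v 0 = mv M v 1 * s := by simpa [wedge, sub_eq_zero] using h10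
    have h13 : algebraMap K C (r 0) * mv M v 0 + algebraMap K C (r 1) * mv M v 1 = 0 := by
      have e0 := congrArg (algebraMap K C) (h11 0)
      have e1 := congrArg (algebraMap K C) (h11 1)
      simp only [map_add, map_mul, map_zero] at e0 e1
      simp only [mv]
      linear_combination v 0 * e0 + v 1 * e1
    have h14 : mv M v 1 ≠ 0 := fun h => hMv (by
      ext i
      fin_cases i <;> simp [h12, h])
    have h15 : algebraMap K C (r 0) * s + algebraMap K C (r 1) = 0 := by
      apply mul_right_cancel₀ h14
      rw [zero_mul, ← h13, h12]
      ring
    have h16 : r 0 ≠ 0 := fun h => hr (by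
      have : r 1 = 0 := by simpa [h] using h15
      ext i
      fin_cases i <;> simp [h, this])
    refine hs ⟨-(r 1) / r 0, ?_⟩
    have : algebraMap K C (r 0) ≠ 0 := by simpa using h16
    rw [map_div₀, map_neg]
    field_simp
    linear_combination -h15

end

/-! ### Theta products and the period pairing. -/

section

variable {K : Type*} [NontriviallyNormedField K]
  {C : Type*} [NormedField C] [NormedAlgebra K C]

/-- `x` and `y` lie in different orbits of `Γ`. -/
def Separated (Γ : Subgroup PGL(2, K)) (x y : P1 C) : Prop := ∀ γ : Γ, x ≠ act (γ : PGL(2, K)) y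

variable {Γ : Subgroup PGL(2, K)} {x y z w v a b b' : P1 C}

lemma Separated.symm (h : Separated Γ x y) : Separated Γ y x := fun γ hγ => h γ⁻¹ (by
  rw [hγ, ← act_mul]
  simp [act_one])

lemma Separated.act_right (h : Separated Γ x y) (α : Γ) :
    Separated Γ x (act (α : PGL(2, K)) y) := fun γ hγ => h (γ * α) (by
  rw [hγ, ← act_mul]
  simp)

lemma Separated.act_left (h : Separated Γ x y) (α : Γ) :
    Separated Γ (act (α : PGL(2, K)) x) y := (h.symm.act_right α).symm

lemma Separated.exists_le_chordalDist (h : Separated Γ x y) (hx : x ∈ ordinarySet C Γ) :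
    ∃ c > 0, ∀ γ : Γ, c ≤ chordalDist x (act (γ : PGL(2, K)) y) := by
  refine exists_pos_le_of_forall_injective (fun γ => chordalDist_pos (h γ)) fun γ hγ hlim => ?_
  refine hx ⟨y, γ, hγ, hlim.congr fun n => chordalDist_comm _ _⟩

/-- The distance is a constant over `rho γ` times the norms of two transformed vectors; these norms
are bounded below at ordinary points, and `rho γ` tends to infinity. -/
lemma tendsto_chordalDist_act [ProperSpace K] (hΓ : IsSchottky Γ) (hx : x ∈ ordinarySet C Γ)
    (hy : y ∈ ordinarySet C Γ) :
    Tendsto (fun γ : Γ => chordalDist (act (γ : PGL(2, K)) x) (act (γ : PGL(2, K)) y))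
      cofinite (𝓝 0) := by
  induction x using Projectivization.ind with | _ u hu
  induction y using Projectivization.ind with | _ v hv
  obtain ⟨c, hc, hcu⟩ := exists_le_norm_mv_lift hΓ hu hx
  obtain ⟨d, hd, hdv⟩ := exists_le_norm_mv_lift hΓ hv hy
  have h := (tendsto_inv_rho hΓ).mul_const (‖wedge u v‖ / (c * d))
  rw [zero_mul] at h
  refine squeeze_zero (fun n => chordalDist_nonneg _ _) (fun γ => ?_) h
  have h1 := hcu γ
  have h2 := hdv γ
  have h3 := rho_pos (γ : PGL(2, K))
  rw [chordalDist_act_mk, mul_div_assoc]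
  gcongr

/-- The quadruples of points for which the product of the cross ratios over an orbit converges
to a non-zero value. -/
structure Regular (Γ : Subgroup PGL(2, K)) (z w a b : P1 C) : Prop where
  hz : z ∈ ordinarySet C Γ
  hw : w ∈ ordinarySet C Γ
  ha : a ∈ ordinarySet C Γ
  hb : b ∈ ordinarySet C Γ
  za : Separated Γ z a
  zb : Separated Γ z b
  wa : Separated Γ w a
  wb : Separated Γ w b

lemma Regular.symm (h : Regular Γ z w a b) : Regular Γ a b z w :=
  ⟨h.ha, h.hb, h.hz, h.hw, h.za.symm, h.wa.symm, h.zb.symm, h.wb.symm⟩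

lemma Regular.swap_right (h : Regular Γ z w a b) : Regular Γ z w b a :=
  ⟨h.hz, h.hw, h.hb, h.ha, h.zb, h.za, h.wb, h.wa⟩

/-- A factor differs from 1 by a multiple of the distance from γa to γb, which tends to 0; the
denominators stay away from 0 because z and w are not limit points. -/
lemma Regular.multipliable [IsUltrametricDist C] [CompleteSpace C] [ProperSpace K]
    (hΓ : IsSchottky Γ) (h : Regular Γ z w a b) :
    Multipliable fun γ : Γ => crossRatio z w (act (γ : PGL(2, K)) a) (act (γ : PGL(2, K)) b) := by
  apply multipliable_of_tendsto_norm_sub_one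
  obtain ⟨c, hc, hc'⟩ := h.zb.exists_le_chordalDist h.hz
  obtain ⟨d, hd, hd'⟩ := h.wa.exists_le_chordalDist h.hw
  have hlim := (tendsto_chordalDist_act hΓ h.ha h.hb).const_mul (chordalDist z w / (c * d))
  rw [mul_zero] at hlim
  refine squeeze_zero (fun n => norm_nonneg _) (fun γ => ?_) hlim
  have h1 := hc' γ
  have h2 := hd' γ
  have h0 := hc.trans_le h1
  have h3 := chordalDist_nonneg z w
  have h4 := chordalDist_nonneg (act (γ : PGL(2, K)) a) (act (γ : PGL(2, K)) b)
  rw [norm_crossRatio_sub_one (h.zb γ) (h.wa γ), div_mul_eq_mul_div]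
  gcongr

/-- Reciprocity: replacing γ by γ⁻¹ moves the group element from one pair of points to the other. -/
lemma theta_symm (z w a b : P1 C) : theta Γ w a b z = theta Γ b z w a := by
  unfold theta
  rw [← (Equiv.inv Γ).tprod_eq]
  refine tprod_congr fun γ => ?_
  rw [crossRatio_symm, ← crossRatio_act (γ : PGL(2, K)), ← act_mul, ← act_mul]
  simp [act_one]

lemma theta_act_right (z w a b : P1 C) (α : Γ) :
    theta Γ w (act (α : PGL(2, K)) a) (act (α : PGL(2, K)) b) z = theta Γ w a b z := by
  unfold theta
  rw [← (Equiv.mulRight α).tprod_eq fun γ : Γ =>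
    crossRatio z w (act (γ : PGL(2, K)) a) (act (γ : PGL(2, K)) b)]
  refine tprod_congr fun γ => ?_
  simp [act_mul]

lemma theta_act_left (z w a b : P1 C) (α : Γ) :
    theta Γ (act (α : PGL(2, K)) w) a b (act (α : PGL(2, K)) z) = theta Γ w a b z := by
  rw [theta_symm, theta_act_right, ← theta_symm]

lemma theta_self (h : Regular Γ z w a b) : theta Γ z a b z = 1 := by
  unfold theta
  rw [← tprod_one (α := C) (β := Γ)]
  refine tprod_congr fun γ => ?_
  have h1 := (bracket_eq_zero_iff _ _).not.2 (h.za γ)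
  have h2 := (bracket_eq_zero_iff _ _).not.2 (h.zb γ)
  rw [crossRatio, mul_comm]
  exact div_self (mul_ne_zero h2 h1)

section Identities

variable [IsUltrametricDist C] [CompleteSpace C] [ProperSpace K] (hΓ : IsSchottky Γ)

include hΓ

lemma theta_mul_left (h : Regular Γ z w a b) (h' : Regular Γ w v a b) :
    theta Γ w a b z * theta Γ v a b w = theta Γ v a b z := by
  unfold theta
  rw [← (h.multipliable hΓ).tprod_mul (h'.multipliable hΓ)]
  exact tprod_congr fun γ => crossRatio_mul_left (h.wa γ) (h.wb γ)

/-- Exchanging z and w gives the inverse. -/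
lemma theta_ne_zero (h : Regular Γ z w a b) : theta Γ w a b z ≠ 0 := by
  have := theta_mul_left hΓ h h.symm.swap_right.symm
  rw [theta_self h] at this
  exact left_ne_zero_of_mul_eq_one this

end Identities

/-- The automorphy factor at `α` of `θ(b, γ b; ·)`, computed at the point `z`. -/
def period (z b : P1 C) (γ α : Γ) : C :=
  theta Γ (act (α : PGL(2, K)) z) b (act (γ : PGL(2, K)) b) z

/-- Ordinary points in different orbits. -/
structure Admissible (Γ : Subgroup PGL(2, K)) (z b : P1 C) : Prop where
  hz : z ∈ ordinarySet C Γ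
  hb : b ∈ ordinarySet C Γ
  sep : Separated Γ z b

lemma Admissible.symm (h : Admissible Γ z b) : Admissible Γ b z := ⟨h.hb, h.hz, h.sep.symm⟩

lemma Admissible.regular (h : Admissible Γ z a) (h' : Admissible Γ w a) (k : Admissible Γ z b)
    (k' : Admissible Γ w b) : Regular Γ z w a b :=
  ⟨h.hz, h'.hz, h.hb, k.hb, h.sep, k.sep, h'.sep, k'.sep⟩

lemma period_symm (z b : P1 C) (γ α : Γ) : period z b γ α = period b z α γ := by
  unfold period
  rw [theta_symm]

lemma mem_regularSet_iff {b z : P1 C} (γ : Γ) :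
    z ∈ regularSet Γ b (act (γ : PGL(2, K)) b) ↔ z ∈ ordinarySet C Γ ∧ Separated Γ z b := by
  constructor
  · rintro ⟨h1, h2⟩
    exact ⟨h1, fun δ => (h2 δ).1⟩
  · rintro ⟨h1, h2⟩
    exact ⟨h1, fun δ => ⟨h2 δ, h2.act_right γ δ⟩⟩

lemma admissible_of_mem_regularSet {γ : Γ} (hb : b ∈ ordinarySet C Γ)
    (hz : z ∈ regularSet Γ b (act (γ : PGL(2, K)) b)) : Admissible Γ z b := by
  rw [mem_regularSet_iff] at hz
  exact ⟨hz.1, hb, hz.2⟩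

/-- A point outside two given orbits. -/
lemma exists_admissible [ProperSpace K] (hΓ : IsSchottky Γ) {t : C}
    (ht : t ∉ Set.range (algebraMap K C)) (ha : a ∈ ordinarySet C Γ)
    (hb : b ∈ ordinarySet C Γ) : ∃ z, Admissible Γ z a ∧ Admissible Γ z b := by
  have := countable_of_isSchottky hΓ
  -- The points t + u with u in K are uncountably many and ordinary, whereas the two orbits are
  -- countable.
  set f : K → P1 C := fun u => affinePt (t + algebraMap K C u) with hf
  have hfi : Function.Injective f := fun u v huv => by
    simpa using affinePt_injective huv
  have hu : ∀ u : K, t + algebraMap K C u ∉ Set.range (algebraMap K C) := by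
    rintro u ⟨v, hv⟩
    exact ht ⟨v - u, by rw [map_sub, hv, add_sub_cancel_right]⟩
  set S : Set (P1 C) := (Set.range fun γ : Γ => act (γ : PGL(2, K)) a) ∪
    Set.range fun γ : Γ => act (γ : PGL(2, K)) b with hS
  have hSc : S.Countable := (Set.countable_range _).union (Set.countable_range _)
  obtain ⟨u, hu'⟩ : ∃ u, f u ∉ S := by
    by_contra! h
    have h1 : (Set.univ : Set K).Countable :=
      (hSc.preimage hfi).mono fun u _ => h u
    have h2 : Cardinal.continuum ≤ Cardinal.mk K :=
      have : CompleteSpace K := inferInstance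
      continuum_le_cardinal_of_nontriviallyNormedField K
    rw [← Cardinal.le_aleph0_iff_set_countable, Cardinal.mk_univ] at h1
    exact absurd (h2.trans h1) (not_le.2 Cardinal.aleph0_lt_continuum)
  simp only [hS, Set.mem_union, Set.mem_range, not_or, not_exists] at hu'
  have hΩ := affinePt_mem_ordinarySet hΓ (hu u)
  exact ⟨f u, ⟨hΩ, ha, fun γ h => hu'.1 γ h.symm⟩, ⟨hΩ, hb, fun γ h => hu'.2 γ h.symm⟩⟩

section Period

variable [IsUltrametricDist C]

lemma Admissible.act_left (h : Admissible Γ z b) (α : Γ) :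
    Admissible Γ (act (α : PGL(2, K)) z) b :=
  ⟨act_mem_ordinarySet h.hz α, h.hb, h.sep.act_left α⟩

lemma Admissible.act_right (h : Admissible Γ z b) (α : Γ) :
    Admissible Γ z (act (α : PGL(2, K)) b) := (h.symm.act_left α).symm

lemma Admissible.regular_act (h : Admissible Γ z b) (h' : Admissible Γ w b) (γ : Γ) :
    Regular Γ z w b (act (γ : PGL(2, K)) b) :=
  h.regular h' (h.act_right γ) (h'.act_right γ)

lemma period_one_right (h : Admissible Γ z b) (γ : Γ) : period z b γ 1 = 1 := by
  unfold period
  rw [OneMemClass.coe_one, act_one]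
  exact theta_self (h.regular_act h γ)

variable [CompleteSpace C] [ProperSpace K] (hΓ : IsSchottky Γ)
include hΓ

lemma period_ne_zero (h : Admissible Γ z b) (γ α : Γ) : period z b γ α ≠ 0 :=
  theta_ne_zero hΓ (h.regular_act (h.act_left α) γ)

/-- The ratio of the values of the theta function at z and w does not change when α moves both
points. -/
lemma period_eq_of_left (h : Admissible Γ z b) (h' : Admissible Γ w b) (γ α : Γ) :
    period z b γ α = period w b γ α := by
  unfold period
  have h1 := theta_mul_left hΓ (h.regular_act h' γ) (h'.regular_act (h'.act_left α) γ)
  have h2 := theta_mul_left hΓ (h.regular_act (h'.act_left α) γ)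
    ((h'.act_left α).regular_act (h.act_left α) γ)
  have h3 := theta_mul_left hΓ (h.regular_act h' γ) (h'.regular_act h γ)
  rw [theta_self (h.regular_act h' γ)] at h3
  rw [theta_act_left] at h2
  rw [← h2, ← h1]
  linear_combination theta Γ (act (α : PGL(2, K)) w) b (act (γ : PGL(2, K)) b) w * h3

lemma period_eq_of_right (h : Admissible Γ z a) (h' : Admissible Γ z b) (γ α : Γ) :
    period z a γ α = period z b γ α := by
  rw [period_symm, period_symm z b]
  exact period_eq_of_left hΓ h.symm h'.symm α γ

/-- Pass from z to βz and from there to αβz, evaluating the factor of α at the point βz. -/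
lemma period_mul_right (h : Admissible Γ z b) (γ α β : Γ) :
    period z b γ (α * β) = period z b γ α * period z b γ β := by
  rw [period_eq_of_left hΓ h (h.act_left β) γ α]
  unfold period
  rw [mul_comm]
  have h1 := theta_mul_left hΓ (h.regular_act (h.act_left β) γ)
    ((h.act_left β).regular_act ((h.act_left β).act_left α) γ)
  rw [h1, Subgroup.coe_mul, act_mul]

/-- The pairing `Γ × Γ → Cˣ` given by the automorphy factors, as a homomorphism. -/
def periodHom (h : Admissible Γ z b) : Γ →* CharGroup C Γ where
  toFun γ :=
    { toFun := fun α => Units.mk0 (period z b γ α) (period_ne_zero hΓ h γ α)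
      map_one' := Units.ext (period_one_right h γ)
      map_mul' := fun α β => Units.ext (period_mul_right hΓ h γ α β) }
  map_one' := by
    ext α
    change period z b 1 α = 1
    rw [period_symm]
    exact period_one_right h.symm α
  map_mul' := fun γ δ => by
    ext α
    change period z b (γ * δ) α = period z b γ α * period z b δ α
    rw [period_symm, period_symm z b γ, period_symm z b δ]
    exact period_mul_right hΓ h.symm α γ δ

lemma periodHom_apply (h : Admissible Γ z b) (γ α : Γ) :
    ((periodHom hΓ h γ α : Cˣ) : C) = period z b γ α := rfl

/-- The auxiliary point v is needed because z may lie in the orbit of b'. -/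
lemma period_eq {t : C} (ht : t ∉ Set.range (algebraMap K C)) {z' : P1 C} (h : Admissible Γ z b)
    (h' : Admissible Γ z' b') (γ α : Γ) : period z b γ α = period z' b' γ α := by
  obtain ⟨v, hv, hv'⟩ := exists_admissible hΓ ht h.hb h'.hb
  rw [period_eq_of_left hΓ h hv, period_eq_of_right hΓ hv hv', period_eq_of_left hΓ hv' h']

lemma isAutomorphyFactor_periodHom {t : C} (ht : t ∉ Set.range (algebraMap K C))
    (h : Admissible Γ z a) (γ : Γ) (hb : b ∈ ordinarySet C Γ) :
    IsAutomorphyFactor Γ b (act (γ : PGL(2, K)) b) (periodHom hΓ h γ) := by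
  intro w hw v hv α
  have hw' := admissible_of_mem_regularSet hb hw
  have hv' := admissible_of_mem_regularSet hb hv
  rw [periodHom_apply, period_eq hΓ ht h hv']
  exact (theta_mul_left hΓ (hv'.regular_act (hv'.act_left α) γ)
    ((hv'.act_left α).regular_act hw' γ)).symm

lemma periodChar_eq {t : C} (ht : t ∉ Set.range (algebraMap K C)) (h : Admissible Γ z b)
    (ha : a ∈ ordinarySet C Γ) (γ : Γ) : periodChar Γ a γ = periodHom hΓ h γ := by
  have hex : ∃ χ : CharGroup C Γ, IsAutomorphyFactor Γ a (act (γ : PGL(2, K)) a) χ :=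
    ⟨_, isAutomorphyFactor_periodHom hΓ ht h γ ha⟩
  have h1 : periodChar Γ a γ = hex.choose := by
    rw [periodChar, automorphyFactor, dif_pos hex]
  have h2 := hex.choose_spec
  rw [← h1] at h2
  -- A regular point is needed: over an empty regular set every character would qualify as an
  -- automorphy factor.
  obtain ⟨v, hv, -⟩ := exists_admissible hΓ ht ha ha
  have hv' : v ∈ regularSet Γ a (act (γ : PGL(2, K)) a) :=
    (mem_regularSet_iff γ).2 ⟨hv.hz, hv.sep⟩
  ext α
  have h3 := h2 v hv' v hv' α
  have h4 := isAutomorphyFactor_periodHom hΓ ht h γ ha v hv' v hv' α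
  rw [h3] at h4
  exact mul_right_cancel₀ (theta_ne_zero hΓ ((hv.act_left α).regular_act hv γ)) h4

end Period

end

section

/-! ### The standard form on integral chains. -/

section Lattice

variable {O : Type*}

/-- The standard symmetric bilinear form on finitely supported integral functions. -/
def ip (F G : O →₀ ℤ) : ℤ := F.sum fun o n => n * G o

lemma ip_add_left (F F' G : O →₀ ℤ) : ip (F + F') G = ip F G + ip F' G :=
  Finsupp.sum_add_index' (by simp) (by intros; ring)

lemma ip_zero_left (G : O →₀ ℤ) : ip 0 G = 0 := Finsupp.sum_zero_index

lemma ip_add_right (F G G' : O →₀ ℤ) : ip F (G + G') = ip F G + ip F G' := by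
  simp [ip, mul_add, Finsupp.sum_add]

lemma ip_zero_right (F : O →₀ ℤ) : ip F 0 = 0 := by simp [ip]

lemma ip_neg_left (F G : O →₀ ℤ) : ip (-F) G = -ip F G := by
  have := ip_add_left F (-F) G
  rw [add_neg_cancel, ip_zero_left] at this
  omega

lemma ip_neg_right (F G : O →₀ ℤ) : ip F (-G) = -ip F G := by
  have := ip_add_right F G (-G)
  rw [add_neg_cancel, ip_zero_right] at this
  omega

lemma ip_single [DecidableEq O] (o o' : O) :
    ip (Finsupp.single o 1) (Finsupp.single o' 1) = if o = o' then 1 else 0 := by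
  simp [ip, Finsupp.single_apply, eq_comm]

lemma ip_self (F : O →₀ ℤ) : ip F F = ∑ o ∈ F.support, F o ^ 2 := by
  simp [ip, Finsupp.sum, pow_two]

lemma ip_self_eq_zero {F : O →₀ ℤ} (h : ip F F = 0) : F = 0 := by
  rw [ip_self, Finset.sum_eq_zero_iff_of_nonneg fun _ _ => sq_nonneg _] at h
  ext o
  by_cases ho : o ∈ F.support
  · simpa using h o ho
  · simpa using ho

lemma ip_self_nonneg (F : O →₀ ℤ) : 0 ≤ ip F F := by
  rw [ip_self]
  positivity

lemma sq_le_ip_self (F : O →₀ ℤ) (o : O) : F o ^ 2 ≤ ip F F := by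
  by_cases ho : o ∈ F.support
  · rw [ip_self]
    exact Finset.single_le_sum (f := fun o => F o ^ 2) (fun _ _ => sq_nonneg _) ho
  · rw [Finsupp.notMem_support_iff.1 ho]
    simpa using ip_self_nonneg F

end Lattice

/-! ### Free actions on trees: chains, cochains and potentials. -/

section Tree

variable {G : Type*} [Group G]

/-- `EdgePath U δ x y l` says that `l` is a list of consecutive edges leading from the vertex `x`
to the vertex `y`. Here the vertices are the cosets `g U` and the element `g` represents the
oriented edge from `g U` to `g δ U`. -/
inductive EdgePath (U : Subgroup G) (δ : G) : G → G → List G → Prop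
  | nil {x y : G} (h : x⁻¹ * y ∈ U) : EdgePath U δ x y []
  | cons {x y u : G} {l : List G} (hu : u ∈ U) (h : EdgePath U δ (x * u * δ) y l) :
      EdgePath U δ x y (x * u :: l)

variable {Γ U : Subgroup G} {δ w : G}

lemma EdgePath.prod_eq {x y : G} {l : List G} (hl : EdgePath U δ x y l) {A : Type*} [CommGroup A]
    {h : G → A} (hU : ∀ g, ∀ u ∈ U, h (g * u) = h g) :
    (l.map fun e => (h e)⁻¹ * h (e * δ)).prod = (h x)⁻¹ * h y := by
  induction hl with
  | @nil x y hxy =>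
    have := hU x _ hxy
    rw [mul_inv_cancel_left] at this
    simp [this]
  | @cons x y u l hu _ ih =>
    rw [List.map_cons, List.prod_cons, ih, hU x u hu]
    group

lemma EdgePath.sum_eq {x y : G} {l : List G} (hl : EdgePath U δ x y l) {h : G → ℝ}
    (hU : ∀ g, ∀ u ∈ U, h (g * u) = h g) :
    (l.map fun e => h (e * δ) - h e).sum = h y - h x := by
  induction hl with
  | @nil x y hxy =>
    have := hU x _ hxy
    rw [mul_inv_cancel_left] at this
    simp [this]
  | @cons x y u l hu _ ih =>
    rw [List.map_cons, List.sum_cons, ih, hU x u hu]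
    ring

/-- The stabiliser of the edge from `U` to `δ U`. -/
def edgeStab (U : Subgroup G) (δ : G) : Subgroup G where
  carrier := {g | g ∈ U ∧ δ⁻¹ * g * δ ∈ U}
  one_mem' := ⟨one_mem _, by simp [one_mem]⟩
  mul_mem' := by
    rintro a b ⟨ha, ha'⟩ ⟨hb, hb'⟩
    refine ⟨mul_mem ha hb, ?_⟩
    rw [show δ⁻¹ * (a * b) * δ = (δ⁻¹ * a * δ) * (δ⁻¹ * b * δ) by group]
    exact mul_mem ha' hb'
  inv_mem' := by
    rintro a ⟨ha, ha'⟩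
    refine ⟨inv_mem ha, ?_⟩
    rw [show δ⁻¹ * a⁻¹ * δ = (δ⁻¹ * a * δ)⁻¹ by group]
    exact inv_mem ha'

/-- A group `G` acting on a tree with vertices `G / U`, such that `δ w` reverses the edge from `U`
to `δ U`, and a subgroup `Γ` acting freely. -/
structure TreeDatum (Γ U : Subgroup G) (δ w : G) : Prop where
  w_mem : w ∈ U
  flip_mem : δ * w * δ ∈ U
  flip_flip : δ * w * (δ * w) = 1
  flip_not_mem : δ * w ∉ U
  free : ∀ γ ∈ Γ, ∀ g, g⁻¹ * γ * g ∈ U → γ = 1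
  sq_eq_one : ∀ γ ∈ Γ, γ * γ = 1 → γ = 1

namespace TreeDatum

variable (h : TreeDatum Γ U δ w)
include h

lemma flip_inv : (δ * w)⁻¹ = δ * w := inv_eq_of_mul_eq_one_left h.flip_flip

lemma flip_conj_mem {i : G} (hi : i ∈ edgeStab U δ) : δ * w * i * (δ * w) ∈ edgeStab U δ := by
  constructor
  · rw [show δ * w * i * (δ * w) = (δ * w)⁻¹ * i * (δ * w) by rw [h.flip_inv],
      show (δ * w)⁻¹ * i * (δ * w) = w⁻¹ * (δ⁻¹ * i * δ) * w by group]
    exact mul_mem (mul_mem (inv_mem h.w_mem) hi.2) h.w_mem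
  · rw [show δ * w * i * (δ * w) = (δ * w)⁻¹ * i * (δ * w) by rw [h.flip_inv],
      show δ⁻¹ * ((δ * w)⁻¹ * i * (δ * w)) * δ = (δ * w * δ)⁻¹ * i * (δ * w * δ) by group]
    exact mul_mem (mul_mem (inv_mem h.flip_mem) hi.1) h.flip_mem

end TreeDatum

variable (Γ U δ) in
/-- The oriented edges of the quotient of the tree by `Γ`. -/
abbrev EdgeOrbit : Type _ := DoubleCoset.Quotient (Γ : Set G) (edgeStab U δ : Set G)

variable (Γ U δ) in
/-- The orbit of an oriented edge. -/
abbrev orb (e : G) : EdgeOrbit Γ U δ := DoubleCoset.mk Γ (edgeStab U δ) e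

lemma orb_eq_iff {e f : G} : orb Γ U δ e = orb Γ U δ f ↔ ∃ γ : Γ, e⁻¹ * γ * f ∈ edgeStab U δ := by
  rw [orb, orb, DoubleCoset.eq]
  constructor
  · rintro ⟨γ, hγ, i, hi, rfl⟩
    exact ⟨⟨γ, hγ⟩⁻¹, by simpa [mul_assoc] using hi⟩
  · rintro ⟨γ, hγ⟩
    exact ⟨γ⁻¹, inv_mem γ.2, _, hγ, by group⟩

namespace TreeDatum

variable (h : TreeDatum Γ U δ w)
include h

lemma orb_flip_flip (e : G) : orb Γ U δ (e * (δ * w) * (δ * w)) = orb Γ U δ e := by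
  rw [mul_assoc, h.flip_flip, mul_one]

lemma orb_flip {e f : G} (hef : orb Γ U δ e = orb Γ U δ f) :
    orb Γ U δ (e * (δ * w)) = orb Γ U δ (f * (δ * w)) := by
  obtain ⟨γ, hγ⟩ := orb_eq_iff.1 hef
  refine orb_eq_iff.2 ⟨γ, ?_⟩
  have := h.flip_conj_mem hγ
  rwa [show (e * (δ * w))⁻¹ * γ * (f * (δ * w)) = (δ * w)⁻¹ * (e⁻¹ * γ * f) * (δ * w) by group,
    h.flip_inv]

/-- If γ in Γ reverses an edge, then γ² fixes it, so γ² = 1 and γ = 1, which reverses nothing. The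
quotient graph can therefore be oriented. -/
lemma orb_flip_ne (e : G) : orb Γ U δ e ≠ orb Γ U δ (e * (δ * w)) := fun he => by
  obtain ⟨γ, hγ⟩ := orb_eq_iff.1 he
  have h1 := mul_mem hγ (h.flip_conj_mem hγ)
  have h2 : e⁻¹ * γ * (e * (δ * w)) * (δ * w * (e⁻¹ * γ * (e * (δ * w))) * (δ * w)) =
      e⁻¹ * γ * e * ((δ * w) * (δ * w)) * (e⁻¹ * γ * e) * ((δ * w) * (δ * w)) := by group
  rw [h2, h.flip_flip, mul_one, mul_one, show e⁻¹ * γ * e * (e⁻¹ * γ * e) = e⁻¹ * (γ * γ : G) * e by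
    group] at h1
  have h3 := h.sq_eq_one γ γ.2 (h.free _ (mul_mem γ.2 γ.2) e h1.1)
  rw [h3] at hγ
  exact h.flip_not_mem (by simpa using hγ.1)

lemma eq_of_mem_edgeStab {e f : G} {γ γ' : Γ} (h1 : e⁻¹ * γ * f ∈ edgeStab U δ)
    (h2 : e⁻¹ * γ' * f ∈ edgeStab U δ) : γ = γ' := by
  have h3 := (mul_mem (inv_mem h1) h2).1
  rw [show (e⁻¹ * γ * f)⁻¹ * (e⁻¹ * γ' * f) = f⁻¹ * ((γ : G)⁻¹ * γ') * f by group] at h3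
  exact Subtype.ext (inv_mul_eq_one.1 (h.free _ (mul_mem (inv_mem γ.2) γ'.2) f h3))

open scoped Classical in
lemma hasSum_edgeStab (e f : G) :
    HasSum (fun γ : Γ => if e⁻¹ * γ * f ∈ edgeStab U δ then (1 : ℝ) else 0)
      (if orb Γ U δ e = orb Γ U δ f then 1 else 0) := by
  split_ifs with hef
  · obtain ⟨γ₀, hγ₀⟩ := orb_eq_iff.1 hef
    refine (hasSum_ite_eq γ₀ (1 : ℝ)).congr_fun fun γ => ?_
    by_cases hγ : γ = γ₀
    · simp [hγ, hγ₀]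
    · rw [if_neg hγ, if_neg fun h' => hγ (h.eq_of_mem_edgeStab h' hγ₀)]
  · refine hasSum_zero.congr_fun fun γ => ?_
    rw [if_neg fun h' => hef (orb_eq_iff.2 ⟨γ, h'⟩)]

end TreeDatum

/-- The signed indicator function of the edge from `U` to `δ U`. -/
def edgeKernel (U : Subgroup G) (δ w g : G) : ℝ :=
  open scoped Classical in
  (if g ∈ edgeStab U δ then 1 else 0) - (if g * (δ * w) ∈ edgeStab U δ then 1 else 0)

open scoped Classical in
variable (Γ U δ w) in
/-- The chain on the quotient graph given by an oriented edge. An orientation of the quotient graph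
is fixed by a well-ordering of the oriented edges. -/
def edgeChain (e : G) : EdgeOrbit Γ U δ →₀ ℤ :=
  if WellOrderingRel (orb Γ U δ e) (orb Γ U δ (e * (δ * w))) then Finsupp.single (orb Γ U δ e) 1
  else -Finsupp.single (orb Γ U δ (e * (δ * w))) 1

variable (Γ U δ w) in
/-- The chain on the quotient graph given by a list of oriented edges. -/
def pathChain (l : List G) : EdgeOrbit Γ U δ →₀ ℤ := (l.map (edgeChain Γ U δ w)).sum

namespace TreeDatum

variable (h : TreeDatum Γ U δ w)
include h

-- Exactly one of an orbit and its reverse precedes the other, so each chain is plus or minus a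
-- basis vector. The four cases are the possible orientations of e and f.
open scoped Classical in
lemma ip_edgeChain (e f : G) : ip (edgeChain Γ U δ w e) (edgeChain Γ U δ w f) =
    (if orb Γ U δ e = orb Γ U δ f then 1 else 0) -
      if orb Γ U δ e = orb Γ U δ (f * (δ * w)) then 1 else 0 := by
  have key : ∀ {e f : G}, orb Γ U δ e = orb Γ U δ (f * (δ * w)) ↔
      orb Γ U δ (e * (δ * w)) = orb Γ U δ f := fun {e f} =>
    ⟨fun h' => (h.orb_flip h').trans (h.orb_flip_flip f),
      fun h' => (h.orb_flip_flip e).symm.trans (h.orb_flip h')⟩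
  have key' : orb Γ U δ (e * (δ * w)) = orb Γ U δ (f * (δ * w)) ↔ orb Γ U δ e = orb Γ U δ f := by
    rw [key, h.orb_flip_flip]
  have hne := h.orb_flip_ne f
  have asymm : ∀ {x y : EdgeOrbit Γ U δ}, WellOrderingRel x y → ¬ WellOrderingRel y x :=
    fun h1 h2 => asymm h1 h2
  have tri : ∀ {x y : EdgeOrbit Γ U δ}, x ≠ y → ¬ WellOrderingRel x y → WellOrderingRel y x :=
    fun h1 h2 => ((trichotomous_of WellOrderingRel _ _).resolve_left h2).resolve_left h1
  unfold edgeChain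
  by_cases he : WellOrderingRel (orb Γ U δ e) (orb Γ U δ (e * (δ * w))) <;>
    by_cases hf : WellOrderingRel (orb Γ U δ f) (orb Γ U δ (f * (δ * w)))
  · rw [if_pos he, if_pos hf, ip_single, if_neg (c := orb Γ U δ e = orb Γ U δ (f * (δ * w))), sub_zero]
    intro h'
    rw [h', key.1 h'] at he
    exact asymm he hf
  · rw [if_pos he, if_neg hf, ip_neg_right, ip_single, if_neg (c := orb Γ U δ e = orb Γ U δ f),
      zero_sub]
    intro h'
    rw [h.orb_flip h', h'] at he
    exact hf he
  · rw [if_neg he, if_pos hf, ip_neg_left, ip_single, if_neg (c := orb Γ U δ e = orb Γ U δ f),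
      zero_sub]
    · simp only [key]
    · intro h'
      rw [h.orb_flip h', h'] at he
      exact he hf
  · rw [if_neg he, if_neg hf, ip_neg_left, ip_neg_right, ip_single, neg_neg,
      if_neg (c := orb Γ U δ e = orb Γ U δ (f * (δ * w))), sub_zero]
    · simp only [key']
    · intro h'
      rw [h', key.1 h'] at he
      exact he (tri hne hf)

lemma hasSum_edgeKernel (e f : G) :
    HasSum (fun γ : Γ => edgeKernel U δ w (e⁻¹ * γ * f))
      (ip (edgeChain Γ U δ w e) (edgeChain Γ U δ w f) : ℤ) := by
  have := (h.hasSum_edgeStab e f).sub (h.hasSum_edgeStab e (f * (δ * w)))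
  rw [h.ip_edgeChain]
  push_cast
  refine this.congr_fun fun γ => ?_
  rw [edgeKernel, mul_assoc _ f]

lemma hasSum_list_edgeKernel (l m : List G) :
    HasSum (fun γ : Γ => (m.map fun e => (l.map fun f => edgeKernel U δ w (e⁻¹ * γ * f)).sum).sum)
      (ip (pathChain Γ U δ w m) (pathChain Γ U δ w l) : ℤ) := by
  unfold pathChain
  induction m with
  | nil => simp [ip_zero_left]
  | cons e m ih =>
    simp only [List.map_cons, List.sum_cons, ip_add_left]
    push_cast
    refine HasSum.add ?_ ih
    clear ih
    induction l with
    | nil => simp [ip_zero_right]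
    | cons f l ih =>
      simp only [List.map_cons, List.sum_cons, ip_add_right]
      push_cast
      exact (h.hasSum_edgeKernel e f).add ih

end TreeDatum

/-- A function on `G` that is invariant under `U` on both sides and whose second difference is a
multiple of the indicator function of an edge, such as the distance function of the tree. -/
structure TreePotential (U : Subgroup G) (δ w : G) (r : ℝ) (L : G → ℝ) : Prop where
  mul_right : ∀ g, ∀ u ∈ U, L (g * u) = L g
  mul_left : ∀ g, ∀ u ∈ U, L (u * g) = L g
  second_diff : ∀ g, L g + L (δ⁻¹ * g * δ) - L (g * δ) - L (δ⁻¹ * g) = r * edgeKernel U δ w g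

/-- The second differences telescope along both paths. -/
lemma TreePotential.sum_eq {r : ℝ} {L : G → ℝ} (hL : TreePotential U δ w r L) {α β : G}
    {l m : List G} (hl : EdgePath U δ 1 α l) (hm : EdgePath U δ 1 β m) (γ : G) :
    L γ + L (β⁻¹ * γ * α) - L (γ * α) - L (β⁻¹ * γ) =
      r * (m.map fun e => (l.map fun f => edgeKernel U δ w (e⁻¹ * γ * f)).sum).sum := by
  have h1 : ∀ y, (l.map fun f => L (y⁻¹ * γ * (f * δ)) - L (y⁻¹ * γ * f)).sum =
      L (y⁻¹ * γ * α) - L (y⁻¹ * γ) := fun y => by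
    rw [hl.sum_eq (h := fun f => L (y⁻¹ * γ * f)), mul_one]
    intro g u hu
    rw [← mul_assoc, hL.mul_right _ u hu]
  have h2 : (m.map fun e => (L ((e * δ)⁻¹ * γ * α) - L ((e * δ)⁻¹ * γ)) -
      (L (e⁻¹ * γ * α) - L (e⁻¹ * γ))).sum = _ := hm.sum_eq
    (h := fun y => L (y⁻¹ * γ * α) - L (y⁻¹ * γ)) fun g u hu => by
      rw [_root_.mul_inv_rev, mul_assoc, mul_assoc, hL.mul_left _ _ (inv_mem hu), mul_assoc,
        hL.mul_left _ _ (inv_mem hu), mul_assoc]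
  have h3 : ∀ e, (L ((e * δ)⁻¹ * γ * α) - L ((e * δ)⁻¹ * γ)) - (L (e⁻¹ * γ * α) - L (e⁻¹ * γ)) =
      r * (l.map fun f => edgeKernel U δ w (e⁻¹ * γ * f)).sum := fun e => by
    rw [← h1, ← h1, ← List.sum_map_mul_left]
    clear h1 h2 hl
    induction l with
    | nil => simp
    | cons f l ih =>
      simp only [List.map_cons, List.sum_cons]
      rw [← ih, ← hL.second_diff]
      have e1 : (e * δ)⁻¹ * γ * (f * δ) = δ⁻¹ * (e⁻¹ * γ * f) * δ := by group
      have e2 : (e * δ)⁻¹ * γ * f = δ⁻¹ * (e⁻¹ * γ * f) := by group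
      have e3 : e⁻¹ * γ * (f * δ) = e⁻¹ * γ * f * δ := by group
      rw [e1, e2, e3]
      ring
  simp only [h3, List.sum_map_mul_left, inv_one, one_mul] at h2
  rw [h2]
  ring

lemma TreePotential.hasSum {r : ℝ} {L : G → ℝ} (hL : TreePotential U δ w r L)
    (h : TreeDatum Γ U δ w) {α β : G} {l m : List G} (hl : EdgePath U δ 1 α l)
    (hm : EdgePath U δ 1 β m) :
    HasSum (fun γ : Γ => L γ + L (β⁻¹ * γ * α) - L (γ * α) - L (β⁻¹ * γ))
      (r * (ip (pathChain Γ U δ w m) (pathChain Γ U δ w l) : ℤ)) := by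
  simp only [hL.sum_eq hl hm]
  exact (h.hasSum_list_edgeKernel l m).mul_left r

/-- A homomorphism from a group acting freely on a tree to a commutative group is given by a
cochain on the quotient graph. -/
lemma TreeDatum.exists_cochain (h : TreeDatum Γ U δ w) {A : Type*} [CommGroup A] (c : Γ →* A) :
    ∃ φ : EdgeOrbit Γ U δ → A, ∀ (α : Γ) (l : List G), EdgePath U δ 1 α l →
      c α = (pathChain Γ U δ w l).prod fun o n => φ o ^ n := by
  classical
  -- a `Γ`-equivariant function on the vertices
  have hrep : ∀ g : G, ∃ γ : Γ, (γ * (DoubleCoset.mk Γ U g).out : G)⁻¹ * g ∈ U := fun g => by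
    obtain ⟨γ, u, hγ, hu, hg⟩ := DoubleCoset.mk_out_eq_mul Γ U g
    refine ⟨⟨γ, hγ⟩⁻¹, ?_⟩
    rw [hg]
    simpa [mul_assoc] using hu
  choose k hk using hrep
  -- Freeness determines the element of Γ that carries the chosen representative to a given vertex;
  -- hence k depends only on the vertex and is equivariant.
  have hk_unique : ∀ (g : G) (γ : Γ), (γ * (DoubleCoset.mk Γ U g).out : G)⁻¹ * g ∈ U →
      k g = γ := fun g γ hγ => by
    set t := (DoubleCoset.mk Γ U g).out
    have h1 := mul_mem hγ (inv_mem (hk g))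
    rw [show ((γ : G) * t)⁻¹ * g * (((k g : G) * t)⁻¹ * g)⁻¹ = t⁻¹ * ((γ : G)⁻¹ * k g) * t by
      group] at h1
    exact Subtype.ext (inv_mul_eq_one.1 (h.free _ (mul_mem (inv_mem γ.2) (k g).2) t h1)).symm
  have hkU : ∀ g, ∀ u ∈ U, k (g * u) = k g := fun g u hu => by
    have hmk : DoubleCoset.mk Γ U (g * u) = DoubleCoset.mk Γ U g :=
      ((DoubleCoset.eq Γ U _ _).2 ⟨1, one_mem _, u, hu, by group⟩).symm
    refine hk_unique _ _ ?_
    rw [hmk, ← mul_assoc]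
    exact mul_mem (hk g) hu
  have hkΓ : ∀ (γ : Γ) (g : G), k (γ * g) = γ * k g := fun γ g => by
    have hmk : DoubleCoset.mk Γ U (γ * g) = DoubleCoset.mk Γ U g :=
      ((DoubleCoset.eq Γ U _ _).2 ⟨γ, γ.2, 1, one_mem _, by group⟩).symm
    refine hk_unique _ _ ?_
    rw [hmk]
    convert hk g using 1
    push_cast
    group
  -- The coboundary of c ∘ k is invariant under Γ, since the two factors c γ cancel, so it descends
  -- to the quotient graph.
  set ψ : G → A := fun e => (c (k e))⁻¹ * c (k (e * δ)) with hψ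
  have hψ_orb : ∀ {e f : G}, orb Γ U δ e = orb Γ U δ f → ψ e = ψ f := fun {e f} hef => by
    obtain ⟨γ, h1, h2⟩ := orb_eq_iff.1 hef
    have h3 : k e = γ * k f := by
      rw [← hkΓ, ← hkU e _ h1]
      congr 1
      group
    have h4 : k (e * δ) = γ * k (f * δ) := by
      rw [← hkΓ, ← hkU (e * δ) _ h2]
      congr 1
      group
    simp only [hψ, h3, h4, map_mul]
    group
  have hψ_flip : ∀ e, ψ (e * (δ * w)) = (ψ e)⁻¹ := fun e => by
    have h1 : k (e * (δ * w)) = k (e * δ) := by rw [← mul_assoc, hkU _ _ h.w_mem]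
    have h2 : k (e * (δ * w) * δ) = k e := by
      rw [show e * (δ * w) * δ = e * (δ * w * δ) by group, hkU _ _ h.flip_mem]
    simp only [hψ, h1, h2]
    group
  refine ⟨fun o => ψ o.out, fun α l hl => ?_⟩
  have hout : ∀ e, ψ (orb Γ U δ e).out = ψ e := fun e =>
    hψ_orb (DoubleCoset.out_eq' Γ (edgeStab U δ) _)
  have hedge : ∀ e, (edgeChain Γ U δ w e).prod (fun o n => ψ o.out ^ n) = ψ e := fun e => by
    unfold edgeChain
    split_ifs
    · rw [Finsupp.prod_single_index (zpow_zero _), zpow_one, hout]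
    · rw [← Finsupp.single_neg, Finsupp.prod_single_index (zpow_zero _), _root_.zpow_neg, zpow_one, hout,
        hψ_flip, inv_inv]
  have hpath : ∀ l : List G,
      (pathChain Γ U δ w l).prod (fun o n => ψ o.out ^ n) = (l.map ψ).prod := fun l => by
    unfold pathChain
    induction l with
    | nil => simp
    | cons e l ih =>
      rw [List.map_cons, List.sum_cons, Finsupp.prod_add_index' (fun _ => zpow_zero _)
        (fun _ _ _ => _root_.zpow_add _ _ _), hedge, ih, List.map_cons, List.prod_cons]
  rw [hpath, hl.prod_eq (h := fun g => c (k g)) fun g u hu => by rw [hkU g u hu]]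
  have h1 : k (α : G) = α * k 1 := by rw [← hkΓ, mul_one]
  rw [h1, map_mul, mul_comm (c α), inv_mul_cancel_left]

end Tree

end

/-! ### The Bruhat-Tits tree in matrix terms. -/

section

variable {K : Type*} [NontriviallyNormedField K]

/-- An element of largest norm below `1`. -/
structure IsUniformizer (π : K) : Prop where
  pos : 0 < ‖π‖
  lt_one : ‖π‖ < 1
  le : ∀ x : K, ‖x‖ < 1 → ‖x‖ ≤ ‖π‖

/-- The open unit ball is also closed, hence compact, and the norm attains its maximum there. -/
lemma exists_isUniformizer [IsUltrametricDist K] [ProperSpace K] : ∃ π : K, IsUniformizer π := by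
  obtain ⟨x, hx0, hx1⟩ := NormedField.exists_norm_lt_one K
  have hcomp : IsCompact (Metric.ball (0 : K) 1) := Metric.isCompact_of_isClosed_isBounded
    (IsUltrametricDist.isClosed_ball 0 1) Metric.isBounded_ball
  obtain ⟨π, hπ, hmax⟩ := hcomp.exists_isMaxOn ⟨x, by simpa using hx1⟩ continuous_norm.continuousOn
  exact ⟨π, hx0.trans_le (hmax (by simpa using hx1)), by simpa using hπ,
    fun y hy => hmax (by simpa using hy)⟩

lemma IsUniformizer.ne_zero {π : K} (hπ : IsUniformizer π) : π ≠ 0 := norm_pos_iff.1 hπ.pos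

lemma IsUniformizer.le_mul {π : K} (hπ : IsUniformizer π) {x y : K} (h : ‖x‖ < ‖y‖) :
    ‖x‖ ≤ ‖π‖ * ‖y‖ := by
  have hy : 0 < ‖y‖ := (norm_nonneg x).trans_lt h
  have := hπ.le (x / y) (by rw [norm_div]; exact (div_lt_one hy).2 h)
  rwa [norm_div, div_le_iff₀ hy] at this

/-- The class of the matrix `diag(π, 1)`. -/
def diagElt (π : K) (hπ : π ≠ 0) : PGL(2, K) :=
  ProjGenLinGroup.mk (GeneralLinearGroup.mkOfDetNeZero !![π, 0; 0, 1] (by simpa))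

/-- The class of the matrix exchanging the coordinates. -/
def swapElt (K : Type*) [Field K] : PGL(2, K) :=
  ProjGenLinGroup.mk (GeneralLinearGroup.mkOfDetNeZero !![0, 1; 1, 0] (by simp))

lemma mk_eq_mk_of_smul {A B : GL (Fin 2) K} {c : K} (hc : c ≠ 0) (h : c • A.val = B.val) :
    ProjGenLinGroup.mk A = ProjGenLinGroup.mk B :=
  ProjGenLinGroup.mk_eq_mk_iff.2 ⟨Units.mk0 c hc, Units.ext (by
    rw [val_scalar_mul, Units.val_mk0, h])⟩

lemma diagElt_inv {π : K} (hπ : π ≠ 0) : (diagElt π hπ)⁻¹ =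
    ProjGenLinGroup.mk (GeneralLinearGroup.mkOfDetNeZero !![1, 0; 0, π] (by simpa)) := by
  rw [inv_eq_iff_mul_eq_one, diagElt, ← map_mul, ← map_one ProjGenLinGroup.mk]
  refine (mk_eq_mk_of_smul hπ ?_).symm
  ext i j
  fin_cases i <;> fin_cases j <;> simp [GeneralLinearGroup.mkOfDetNeZero]

lemma rho_mk_eq (G : GL (Fin 2) K) : rho (ProjGenLinGroup.mk G) =
    max (max ‖G.val 0 0‖ ‖G.val 0 1‖) (max ‖G.val 1 0‖ ‖G.val 1 1‖) ^ 2 / ‖G.val.det‖ := rho_mk G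

lemma rho_mul_diag {π : K} (hπ : π ≠ 0) (G : GL (Fin 2) K) :
    rho (ProjGenLinGroup.mk G * diagElt π hπ) =
      max (max (‖π‖ * ‖G.val 0 0‖) ‖G.val 0 1‖) (max (‖π‖ * ‖G.val 1 0‖) ‖G.val 1 1‖) ^ 2 /
        (‖π‖ * ‖G.val.det‖) := by
  rw [diagElt, ← map_mul, rho_mk_eq, Units.val_mul, Matrix.det_mul]
  simp [Matrix.mul_apply, GeneralLinearGroup.mkOfDetNeZero, mul_comm]

lemma rho_diag_inv_mul {π : K} (hπ : π ≠ 0) (G : GL (Fin 2) K) :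
    rho ((diagElt π hπ)⁻¹ * ProjGenLinGroup.mk G) =
      max (max ‖G.val 0 0‖ ‖G.val 0 1‖) (max (‖π‖ * ‖G.val 1 0‖) (‖π‖ * ‖G.val 1 1‖)) ^ 2 /
        (‖π‖ * ‖G.val.det‖) := by
  rw [diagElt_inv, ← map_mul, rho_mk_eq, Units.val_mul, Matrix.det_mul]
  simp [Matrix.mul_apply, GeneralLinearGroup.mkOfDetNeZero]

lemma rho_diag_inv_mul_diag {π : K} (hπ : π ≠ 0) (G : GL (Fin 2) K) :
    rho ((diagElt π hπ)⁻¹ * ProjGenLinGroup.mk G * diagElt π hπ) =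
      max (max (‖π‖ * ‖G.val 0 0‖) ‖G.val 0 1‖)
        (max (‖π‖ * (‖π‖ * ‖G.val 1 0‖)) (‖π‖ * ‖G.val 1 1‖)) ^ 2 /
        (‖π‖ * (‖π‖ * ‖G.val.det‖)) := by
  rw [diagElt_inv, ← map_mul]
  refine (rho_mul_diag hπ _).trans ?_
  rw [Units.val_mul, Matrix.det_mul]
  simp [Matrix.mul_apply, GeneralLinearGroup.mkOfDetNeZero]

lemma rho_diag {π : K} (hπ : π ≠ 0) (h1 : ‖π‖ < 1) : rho (diagElt π hπ) = ‖π‖⁻¹ := by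
  rw [diagElt, rho_mk_eq]
  simp [GeneralLinearGroup.mkOfDetNeZero, h1.le]

/-- For the entries of a matrix of g, the first alternative says that the second difference of log
`rho` vanishes; the others say that g fixes or reverses the standard edge. With the row maxima r₁,
r₂ for weights (1, 1) and s₁, s₂ for weights (|π|, 1), the identity holds if both pairs compare the
same way, because a strict inequality of norms gains a factor |π|; the mixed cases give the
exceptions. -/
lemma max_sq_trichotomy {π : K} (hπ : IsUniformizer π) (a b c d : K) :
    max (max ‖a‖ ‖b‖) (max ‖c‖ ‖d‖) *
        max (max (‖π‖ * ‖a‖) ‖b‖) (max (‖π‖ * (‖π‖ * ‖c‖)) (‖π‖ * ‖d‖)) =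
      max (max ‖a‖ ‖b‖) (max (‖π‖ * ‖c‖) (‖π‖ * ‖d‖)) *
        max (max (‖π‖ * ‖a‖) ‖b‖) (max (‖π‖ * ‖c‖) ‖d‖) ∨
    (‖a‖ = ‖d‖ ∧ ‖b‖ ≤ ‖π‖ * ‖a‖ ∧ ‖c‖ ≤ ‖a‖ ∧ 0 < ‖a‖) ∨
    (‖b‖ = ‖π‖ * ‖c‖ ∧ ‖a‖ ≤ ‖π‖ * ‖c‖ ∧ ‖d‖ ≤ ‖π‖ * ‖c‖ ∧ 0 < ‖c‖) := by
  have hp := hπ.pos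
  have hp1 := hπ.lt_one
  have comp : ∀ x y : K, ‖x‖ < ‖y‖ → ‖x‖ ≤ ‖π‖ * ‖y‖ := fun _ _ => hπ.le_mul
  -- a maximum of norms is a norm
  have exmax : ∀ x y : K, ∃ z : K, ‖z‖ = max ‖x‖ ‖y‖ := fun x y => by
    rcases max_choice ‖x‖ ‖y‖ with h | h <;> rw [h]
    exacts [⟨x, rfl⟩, ⟨y, rfl⟩]
  obtain ⟨r1, hr1⟩ := exmax a b
  obtain ⟨r2, hr2⟩ := exmax c d
  obtain ⟨s1, hs1⟩ := exmax (π * a) b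
  obtain ⟨s2, hs2⟩ := exmax (π * c) d
  rw [norm_mul] at hs1 hs2
  rw [← mul_max_of_nonneg _ _ hp.le, ← mul_max_of_nonneg _ _ hp.le, ← hr1, ← hr2, ← hs1, ← hs2]
  have small : ∀ x : K, ‖π‖ * ‖x‖ ≤ ‖x‖ := fun x => mul_le_of_le_one_left (norm_nonneg _) hp1.le
  rcases le_or_gt ‖r2‖ ‖r1‖ with h1 | h1 <;> rcases le_or_gt ‖s2‖ ‖s1‖ with h2 | h2
  · left
    rw [max_eq_left h1, max_eq_left h2, max_eq_left ((small _).trans h1),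
      max_eq_left ((small _).trans h2)]
  · right; left
    have hb : ‖b‖ < ‖s2‖ := ((le_max_right _ _).trans_eq hs1.symm).trans_lt h2
    have ha : ‖π‖ * ‖a‖ < ‖s2‖ := ((le_max_left _ _).trans_eq hs1.symm).trans_lt h2
    have hc : ‖c‖ ≤ ‖r1‖ := ((le_max_left _ _).trans_eq hr2.symm).trans h1
    have hd : ‖d‖ ≤ ‖r1‖ := ((le_max_right _ _).trans_eq hr2.symm).trans h1
    rcases le_or_gt ‖d‖ (‖π‖ * ‖c‖) with hdc | hdc
    · rw [max_eq_left hdc] at hs2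
      rw [hs2] at ha hb
      have ha := lt_of_mul_lt_mul_left ha hp.le
      have : ‖r1‖ < ‖c‖ := by
        rw [hr1]
        exact max_lt ha (hb.trans_le (small _))
      exact absurd hc (not_le.2 this)
    · rw [max_eq_right hdc.le] at hs2
      rw [hs2] at ha hb
      have hda : ‖d‖ ≤ ‖a‖ := by
        rw [hr1] at hd
        exact (le_max_iff.1 hd).resolve_right (not_le.2 hb)
      have had : ‖a‖ ≤ ‖d‖ := by
        by_contra! h
        have := comp _ _ h
        exact absurd ha (not_lt.2 this)
      have e := le_antisymm had hda
      refine ⟨e, ?_, ?_, ?_⟩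
      · rw [e]; exact comp _ _ hb
      · rw [e]
        by_contra! h
        have := comp _ _ h
        exact absurd hdc (not_lt.2 this)
      · rw [e]; exact (norm_nonneg b).trans_lt hb
  · right; right
    have ha : ‖a‖ < ‖r2‖ := ((le_max_left _ _).trans_eq hr1.symm).trans_lt h1
    have hb : ‖b‖ < ‖r2‖ := ((le_max_right _ _).trans_eq hr1.symm).trans_lt h1
    have hc : ‖π‖ * ‖c‖ ≤ ‖s1‖ := ((le_max_left _ _).trans_eq hs2.symm).trans h2
    have hd : ‖d‖ ≤ ‖s1‖ := ((le_max_right _ _).trans_eq hs2.symm).trans h2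
    rcases le_or_gt ‖b‖ (‖π‖ * ‖a‖) with hba | hba
    · rw [max_eq_left hba] at hs1
      rw [hs1] at hc hd
      have hc := le_of_mul_le_mul_left hc hp
      have : ‖r2‖ ≤ ‖a‖ := by
        rw [hr2]
        exact max_le hc (hd.trans (small _))
      exact absurd ha (not_lt.2 this)
    · rw [max_eq_right hba.le] at hs1
      rw [hs1] at hc hd
      have hr : ‖r2‖ = ‖c‖ := by
        rw [hr2]
        refine max_eq_left ?_
        by_contra! h
        rw [max_eq_right h.le] at hr2
        exact absurd (hb.trans_eq hr2) (not_lt.2 hd)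
      rw [hr] at ha hb
      have hbc := comp _ _ hb
      exact ⟨le_antisymm hbc hc, comp _ _ ha, hd.trans hbc, (norm_nonneg _).trans_lt ha⟩
  · left
    have h1' : ‖r1‖ ≤ ‖π‖ * ‖r2‖ := comp _ _ h1
    have h2' : ‖s1‖ ≤ ‖π‖ * ‖s2‖ := comp _ _ h2
    rw [max_eq_right h1.le, max_eq_right h2.le, max_eq_right h1', max_eq_right h2']
    ring

end

section

variable {K : Type*} [NontriviallyNormedField K]

lemma flip_flip {π : K} (hπ : π ≠ 0) :
    diagElt π hπ * swapElt K * (diagElt π hπ * swapElt K) = 1 := by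
  rw [diagElt, swapElt, ← map_mul, ← map_mul, ← map_one ProjGenLinGroup.mk]
  refine (mk_eq_mk_of_smul hπ ?_).symm
  ext i j
  fin_cases i <;> fin_cases j <;> simp [GeneralLinearGroup.mkOfDetNeZero, Matrix.mul_apply]

variable [IsUltrametricDist K]

lemma norm_sub_eq_left {x y : K} (h : ‖y‖ < ‖x‖) : ‖x - y‖ = ‖x‖ := by
  rw [sub_eq_add_neg, IsUltrametricDist.norm_add_eq_max_of_norm_ne_norm (by simpa using h.ne'),
    norm_neg, max_eq_left h.le]

lemma swapElt_mem : swapElt K ∈ vertexStab K := by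
  rw [mem_vertexStab, swapElt, rho_mk_eq]
  simp [GeneralLinearGroup.mkOfDetNeZero]

lemma diagElt_not_mem {π : K} (hπ : IsUniformizer π) : diagElt π hπ.ne_zero ∉ vertexStab K := by
  rw [mem_vertexStab, rho_diag hπ.ne_zero hπ.lt_one]
  exact (one_lt_inv_iff₀.2 ⟨hπ.pos, hπ.lt_one⟩).ne'

/-- The action of a Schottky group on the Bruhat-Tits tree of `PGL₂(K)`. -/
lemma treeDatum [ProperSpace K] {Γ : Subgroup PGL(2, K)} (hΓ : IsSchottky Γ) {π : K}
    (hπ : IsUniformizer π) :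
    TreeDatum Γ (vertexStab K) (diagElt π hπ.ne_zero) (swapElt K) where
  w_mem := swapElt_mem
  flip_mem := by
    have := flip_flip hπ.ne_zero
    rw [← mul_assoc, mul_eq_one_iff_eq_inv] at this
    rw [this]
    exact inv_mem swapElt_mem
  flip_flip := flip_flip _
  flip_not_mem h := diagElt_not_mem hπ ((Subgroup.mul_mem_cancel_right _ swapElt_mem).1 h)
  free γ hγ g hg := congrArg Subtype.val (eq_one_of_conj_mem_vertexStab hΓ (γ := ⟨γ, hγ⟩) hg)
  sq_eq_one γ hγ h := hΓ.torsionFree γ hγ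
    (isOfFinOrder_iff_pow_eq_one.2 ⟨2, two_pos, by rw [pow_two, h]⟩)

/-- Up to a scalar the matrix is integral with unit diagonal and lower triangular modulo π, that is,
it lies in an Iwahori subgroup. -/
lemma mem_edgeStab_of_norm {π : K} (hπ : IsUniformizer π) {G : GL (Fin 2) K}
    (h1 : ‖G.val 0 0‖ = ‖G.val 1 1‖) (h2 : ‖G.val 0 1‖ ≤ ‖π‖ * ‖G.val 0 0‖)
    (h3 : ‖G.val 1 0‖ ≤ ‖G.val 0 0‖) (h4 : 0 < ‖G.val 0 0‖) :
    ProjGenLinGroup.mk G ∈ edgeStab (vertexStab K) (diagElt π hπ.ne_zero) := by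
  have hp := hπ.pos
  have hp1 := hπ.lt_one
  set A := ‖G.val 0 0‖ with hA
  have h2' : ‖G.val 0 1‖ ≤ A := h2.trans (mul_le_of_le_one_left h4.le hp1.le)
  have hdet : ‖G.val.det‖ = A ^ 2 := by
    rw [Matrix.det_fin_two, norm_sub_eq_left, norm_mul, ← h1, pow_two]
    rw [norm_mul, norm_mul, ← h1]
    calc ‖G.val 0 1‖ * ‖G.val 1 0‖ ≤ ‖π‖ * A * A := by gcongr
      _ < 1 * A * A := by gcongr
      _ = A * A := by ring
  constructor
  · rw [mem_vertexStab, rho_mk_eq, hdet, ← h1, ← hA, max_eq_left h2', max_eq_right h3, max_self]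
    exact div_self (by positivity)
  · rw [mem_vertexStab, rho_diag_inv_mul_diag, hdet, ← h1, ← hA, max_eq_left h2]
    have h5 : ‖π‖ * (‖π‖ * ‖G.val 1 0‖) ≤ ‖π‖ * A := by
      gcongr
      exact (mul_le_of_le_one_left (norm_nonneg _) hp1.le).trans h3
    rw [max_eq_right h5, max_self]
    field_simp

/-- Multiplication by the flip exchanges the columns and scales one of them by π, which reduces this
to `mem_edgeStab_of_norm`. -/
lemma mul_flip_mem_edgeStab_of_norm {π : K} (hπ : IsUniformizer π) {G : GL (Fin 2) K}
    (h1 : ‖G.val 0 1‖ = ‖π‖ * ‖G.val 1 0‖) (h2 : ‖G.val 0 0‖ ≤ ‖π‖ * ‖G.val 1 0‖)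
    (h3 : ‖G.val 1 1‖ ≤ ‖π‖ * ‖G.val 1 0‖) (h4 : 0 < ‖G.val 1 0‖) :
    ProjGenLinGroup.mk G * (diagElt π hπ.ne_zero * swapElt K) ∈
      edgeStab (vertexStab K) (diagElt π hπ.ne_zero) := by
  have hp := hπ.pos
  rw [diagElt, swapElt, ← map_mul, ← map_mul]
  set E := G * (GeneralLinearGroup.mkOfDetNeZero !![π, 0; 0, 1] (by simpa using hπ.ne_zero) *
    GeneralLinearGroup.mkOfDetNeZero !![0, 1; 1, 0] (by simp)) with hE
  have h00 : E.val 0 0 = G.val 0 1 := by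
    simp [hE, GeneralLinearGroup.mkOfDetNeZero, Matrix.mul_apply]
  have h01 : E.val 0 1 = G.val 0 0 * π := by
    simp [hE, GeneralLinearGroup.mkOfDetNeZero, Matrix.mul_apply]
  have h10 : E.val 1 0 = G.val 1 1 := by
    simp [hE, GeneralLinearGroup.mkOfDetNeZero, Matrix.mul_apply]
  have h11 : E.val 1 1 = G.val 1 0 * π := by
    simp [hE, GeneralLinearGroup.mkOfDetNeZero, Matrix.mul_apply]
  apply mem_edgeStab_of_norm hπ
  · rw [h00, h11, h1, norm_mul, mul_comm]
  · rw [h00, h01, h1, norm_mul, mul_comm]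
    gcongr
  · rw [h00, h10, h1]
    exact h3
  · rw [h00, h1]
    positivity

/-- Half of the distance function of the Bruhat-Tits tree. -/
lemma treePotential {π : K} (hπ : IsUniformizer π) :
    TreePotential (vertexStab K) (diagElt π hπ.ne_zero) (swapElt K) (Real.log ‖π‖)
      (fun g => Real.log (rho g) / 2) where
  mul_right g u hu := by rw [rho_mul_right hu]
  mul_left g u hu := by rw [rho_mul_left hu]
  second_diff g := by
    have hp := hπ.pos
    have hδ := rho_diag hπ.ne_zero hπ.lt_one
    have hff := flip_flip hπ.ne_zero
    have hw := swapElt_mem (K := K)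
    have hδw : diagElt π hπ.ne_zero * swapElt K ∉ vertexStab K := fun h =>
      diagElt_not_mem hπ ((Subgroup.mul_mem_cancel_right _ swapElt_mem).1 h)
    set δ := diagElt π hπ.ne_zero with hδ_def
    set w := swapElt K
    unfold edgeKernel
    by_cases h1 : g ∈ edgeStab (vertexStab K) δ
    · have h2 : g * (δ * w) ∉ edgeStab (vertexStab K) δ := fun h =>
        hδw ((Subgroup.mul_mem_cancel_left _ h1.1).1 h.1)
      rw [if_pos h1, if_neg h2]
      have e1 : rho (g * δ) = ‖π‖⁻¹ := by
        rw [show g * δ = δ * (δ⁻¹ * g * δ) by group, rho_mul_right h1.2, hδ]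
      have e2 : rho (δ⁻¹ * g) = ‖π‖⁻¹ := by rw [rho_mul_right h1.1, rho_inv, hδ]
      simp only [e1, e2, mem_vertexStab.1 h1.1, mem_vertexStab.1 h1.2, Real.log_one, Real.log_inv]
      ring
    · rw [if_neg h1]
      by_cases h2 : g * (δ * w) ∈ edgeStab (vertexStab K) δ
      · rw [if_pos h2]
        set i := g * (δ * w) with hi
        have hg : g = i * (δ * w) := by rw [hi, mul_assoc, hff, mul_one]
        have hflip : δ * w * δ = w⁻¹ := by
          rwa [← mul_assoc, mul_eq_one_iff_eq_inv] at hff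
        have e1 : rho g = ‖π‖⁻¹ := by
          rw [hg, rho_mul_left h2.1, rho_mul_right hw, hδ]
        have e2 : rho (δ⁻¹ * g * δ) = ‖π‖⁻¹ := by
          rw [hg, show δ⁻¹ * (i * (δ * w)) * δ = (δ⁻¹ * i * δ) * (w * δ) by group,
            rho_mul_left h2.2, rho_mul_left hw, hδ]
        have e3 : rho (g * δ) = 1 := by
          rw [hg, mul_assoc, hflip]
          exact mul_mem h2.1 (inv_mem hw)
        have e4 : rho (δ⁻¹ * g) = 1 := by
          rw [hg, show δ⁻¹ * (i * (δ * w)) = (δ⁻¹ * i * δ) * w by group]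
          exact mul_mem h2.2 hw
        simp only [e1, e2, e3, e4, Real.log_one, Real.log_inv]
        ring
      · rw [if_neg h2, sub_self, mul_zero]
        obtain ⟨G, rfl⟩ := ProjGenLinGroup.mk_surjective g
        have hΔ := norm_pos_iff.2 (det_ne_zero G)
        -- The edges differ even up to orientation, so only the product identity survives; its
        -- logarithm is the claim.
        rcases max_sq_trichotomy hπ (G.val 0 0) (G.val 0 1) (G.val 1 0) (G.val 1 1) with
          h | ⟨a1, a2, a3, a4⟩ | ⟨a1, a2, a3, a4⟩
        · have e : rho (ProjGenLinGroup.mk G) * rho (δ⁻¹ * ProjGenLinGroup.mk G * δ) =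
              rho (δ⁻¹ * ProjGenLinGroup.mk G) * rho (ProjGenLinGroup.mk G * δ) := by
            rw [hδ_def, rho_mk_eq, rho_diag_inv_mul_diag, rho_mul_diag, rho_diag_inv_mul,
              div_mul_div_comm, div_mul_div_comm, ← mul_pow, h, mul_pow]
            congr 1
            ring
          have e' := congrArg Real.log e
          rw [Real.log_mul (rho_pos _).ne' (rho_pos _).ne',
            Real.log_mul (rho_pos _).ne' (rho_pos _).ne'] at e'
          linarith
        · exact absurd (mem_edgeStab_of_norm hπ a1 a2 a3 a4) h1
        · exact absurd (mul_flip_mem_edgeStab_of_norm hπ a1 a2 a3 a4) h2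

/-- Moving from the standard vertex to a neighbour decreases the distance to a given vertex. -/
lemma exists_rho_le {π : K} (hπ : IsUniformizer π) {g : PGL(2, K)} (hg : g ∉ vertexStab K) :
    ∃ u ∈ vertexStab K, rho ((u * diagElt π hπ.ne_zero)⁻¹ * g) ≤ ‖π‖ * rho g := by
  have hp := hπ.pos
  -- It suffices to make the first row divisible by π through an integral row operation E; then u =
  -- E⁻¹ points to the closer neighbour.
  have key : ∀ (E : GL (Fin 2) K), ProjGenLinGroup.mk E ∈ vertexStab K → ‖E.val.det‖ = 1 →
      (∀ j, ‖(E.val * (lift g).val) 0 j‖ ≤ ‖π‖) → (∀ j, ‖(E.val * (lift g).val) 1 j‖ ≤ 1) →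
      ∃ u ∈ vertexStab K, rho ((u * diagElt π hπ.ne_zero)⁻¹ * g) ≤ ‖π‖ * rho g := by
    intro E hE hdet h0 h1
    refine ⟨(ProjGenLinGroup.mk E)⁻¹, inv_mem hE, ?_⟩
    have hΔ := norm_pos_iff.2 (det_ne_zero (lift g))
    have e : ((ProjGenLinGroup.mk E)⁻¹ * diagElt π hπ.ne_zero)⁻¹ * g =
        (diagElt π hπ.ne_zero)⁻¹ * ProjGenLinGroup.mk (E * lift g) := by
      rw [map_mul, mk_lift]
      group
    rw [e, rho_diag_inv_mul, rho, Units.val_mul, Matrix.det_mul, norm_mul, hdet, one_mul]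
    have hmax : max (max ‖(E.val * (lift g).val) 0 0‖ ‖(E.val * (lift g).val) 0 1‖)
        (max (‖π‖ * ‖(E.val * (lift g).val) 1 0‖) (‖π‖ * ‖(E.val * (lift g).val) 1 1‖)) ≤
          ‖π‖ :=
      max_le (max_le (h0 _) (h0 _)) (max_le (mul_le_of_le_one_right hp.le (h1 _))
        (mul_le_of_le_one_right hp.le (h1 _)))
    calc _ ≤ ‖π‖ ^ 2 / (‖π‖ * ‖(lift g).val.det‖) := by
          gcongr
      _ = _ := by field_simp
  set M := (lift g).val with hM
  have hle : ∀ i j, ‖M i j‖ ≤ 1 := fun i j =>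
    (norm_le_entryNorm M i j).trans_eq (entryNorm_lift g)
  have hΔ : ‖M.det‖ ≤ ‖π‖ := by
    -- Outside the stabiliser the determinant is not a unit, so the rows are dependent modulo π.
    refine hπ.le _ (lt_of_le_of_ne ?_ fun h => hg ?_)
    · exact (norm_det_le M).trans_eq (by rw [hM, entryNorm_lift, one_pow])
    · rw [mem_vertexStab, rho, ← hM, h, inv_one]
  rw [Matrix.det_fin_two] at hΔ
  obtain ⟨i, k, hik⟩ := exists_norm_eq_entryNorm M
  rw [hM, entryNorm_lift, ← hM] at hik
  have hne : M i k ≠ 0 := norm_pos_iff.1 (hik ▸ one_pos)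
  -- it remains to clear the pivot column in the other row
  have hred : ∀ j, ‖M (1 - i) j - M (1 - i) k / M i k * M i j‖ ≤ ‖π‖ := fun j => by
    have h1 : M (1 - i) j - M (1 - i) k / M i k * M i j =
        (M (1 - i) j * M i k - M (1 - i) k * M i j) / M i k := by field_simp
    rw [h1, norm_div, hik, div_one]
    have hz : ‖(0 : K)‖ ≤ ‖π‖ := by simp
    have h2 : ∀ i j k : Fin 2, M (1 - i) j * M i k - M (1 - i) k * M i j = 0 ∨
        M (1 - i) j * M i k - M (1 - i) k * M i j = M 0 0 * M 1 1 - M 0 1 * M 1 0 ∨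
        M (1 - i) j * M i k - M (1 - i) k * M i j = -(M 0 0 * M 1 1 - M 0 1 * M 1 0) := by
      simp only [Fin.forall_fin_two, sub_zero, sub_self]
      refine ⟨⟨⟨?_, ?_⟩, ?_, ?_⟩, ⟨?_, ?_⟩, ?_, ?_⟩ <;>
        first
        | exact Or.inl trivial
        | exact Or.inr (Or.inl trivial)
        | (right; left; ring1)
        | (right; right; ring1)
    rcases h2 i j k with h2 | h2 | h2 <;> rw [h2]
    exacts [hz, hΔ, (norm_neg _).trans_le hΔ]
  have hc : ‖M (1 - i) k / M i k‖ ≤ 1 := by rw [norm_div, hik, div_one]; exact hle _ _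
  generalize M (1 - i) k / M i k = c at hred hc
  have hcm : ∀ E : GL (Fin 2) K, (∀ i j, ‖E.val i j‖ ≤ 1) → ‖E.val.det‖ = 1 →
      ProjGenLinGroup.mk E ∈ vertexStab K := fun E h1 h2 => by
    rw [mem_vertexStab]
    refine le_antisymm ?_ (one_le_rho _)
    rw [rho_mk, h2, div_one]
    exact pow_le_one₀ (entryNorm_nonneg _) (entryNorm_le h1)
  fin_cases i
  -- With the pivot in the first row, the rows are also exchanged so that the cleared one is on top.
  · refine key (GeneralLinearGroup.mkOfDetNeZero !![-c, 1; 1, 0] (by simp)) (hcm _ ?_ ?_) ?_ ?_ ?_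
    · intro i j
      fin_cases i <;> fin_cases j <;> simp [GeneralLinearGroup.mkOfDetNeZero, hc]
    · simp [GeneralLinearGroup.mkOfDetNeZero]
    · simp [GeneralLinearGroup.mkOfDetNeZero]
    · intro j
      have := hred j
      simp [GeneralLinearGroup.mkOfDetNeZero, Matrix.mul_apply] at this ⊢
      rwa [neg_add_eq_sub]
    · intro j
      simp [GeneralLinearGroup.mkOfDetNeZero, Matrix.mul_apply, hle]
  · refine key (GeneralLinearGroup.mkOfDetNeZero !![1, -c; 0, 1] (by simp)) (hcm _ ?_ ?_) ?_ ?_ ?_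
    · intro i j
      fin_cases i <;> fin_cases j <;> simp [GeneralLinearGroup.mkOfDetNeZero, hc]
    · simp [GeneralLinearGroup.mkOfDetNeZero]
    · simp [GeneralLinearGroup.mkOfDetNeZero]
    · intro j
      have := hred j
      simp [GeneralLinearGroup.mkOfDetNeZero, Matrix.mul_apply] at this ⊢
      rwa [← sub_eq_add_neg]
    · intro j
      simp [GeneralLinearGroup.mkOfDetNeZero, Matrix.mul_apply, hle]

/-- Each step towards y shrinks `rho` by at least the factor |π|, and `rho` is never below 1, so n
bounds the number of steps. -/
lemma exists_edgePath {π : K} (hπ : IsUniformizer π) (x y : PGL(2, K)) :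
    ∃ l, EdgePath (vertexStab K) (diagElt π hπ.ne_zero) x y l := by
  have hp := hπ.pos
  suffices H : ∀ n : ℕ, ∀ x y : PGL(2, K), ‖π‖ ^ n * rho (x⁻¹ * y) ≤ 1 →
      ∃ l, EdgePath (vertexStab K) (diagElt π hπ.ne_zero) x y l by
    obtain ⟨n, hn⟩ := exists_pow_lt_of_lt_one (inv_pos.2 (rho_pos (x⁻¹ * y))) hπ.lt_one
    refine H n x y ?_
    rw [← inv_mul_cancel₀ (rho_pos (x⁻¹ * y)).ne']
    exact mul_le_mul_of_nonneg_right hn.le (rho_pos _).le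
  intro n
  induction n with
  | zero =>
    intro x y h
    rw [pow_zero, one_mul] at h
    exact ⟨[], .nil (le_antisymm h (one_le_rho _))⟩
  | succ n ih =>
    intro x y h
    by_cases hxy : x⁻¹ * y ∈ vertexStab K
    · exact ⟨[], .nil hxy⟩
    · obtain ⟨u, hu, hle⟩ := exists_rho_le hπ hxy
      obtain ⟨l, hl⟩ := ih (x * u * diagElt π hπ.ne_zero) y (by
        rw [show (x * u * diagElt π hπ.ne_zero)⁻¹ * y =
          (u * diagElt π hπ.ne_zero)⁻¹ * (x⁻¹ * y) by group]
        calc _ ≤ ‖π‖ ^ n * (‖π‖ * rho (x⁻¹ * y)) := by gcongr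
          _ = ‖π‖ ^ (n + 1) * rho (x⁻¹ * y) := by ring
          _ ≤ 1 := h)
      exact ⟨_, .cons hu hl⟩

end

section

/-! ### Elements with generic residue. -/

section Generic

variable {K : Type*} [NontriviallyNormedField K] [ProperSpace K]
  {C : Type*} [NormedField C] [NormedAlgebra K C] [IsUltrametricDist C]

lemma norm_sum_lt {ι : Type*} {s : Finset ι} {f : ι → C} {r : ℝ} (hr : 0 < r)
    (h : ∀ i ∈ s, ‖f i‖ < r) : ‖∑ i ∈ s, f i‖ < r := by
  classical
  induction s using Finset.induction_on with
  | empty => simpa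
  | insert a s has ih =>
    rw [Finset.sum_insert has]
    exact (IsUltrametricDist.norm_add_le_max _ _).trans_lt (max_lt (h _ (by simp))
      (ih fun i hi => h i (by simp [hi])))

lemma norm_add_eq_left {x y : C} (h : ‖y‖ < ‖x‖) : ‖x + y‖ = ‖x‖ := by
  rw [IsUltrametricDist.norm_add_eq_max_of_norm_ne_norm h.ne', max_eq_left h.le]

/-- The residue field of a local field is finite. -/
lemma exists_finset_residues : ∃ T : Finset K, (∀ u ∈ T, ‖u‖ ≤ 1) ∧
    ∀ x : K, ‖x‖ ≤ 1 → ∃ u ∈ T, ‖x - u‖ < 1 := by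
  obtain ⟨T, hT, hfin, hcov⟩ := finite_cover_balls_of_compact
    (isCompact_closedBall (0 : K) 1) one_pos
  refine ⟨hfin.toFinset, fun u hu => ?_, fun x hx => ?_⟩
  · simpa using hT (hfin.mem_toFinset.1 hu)
  · obtain ⟨u, hu, hxu⟩ := Set.mem_iUnion₂.1 (hcov (by simpa using hx))
    exact ⟨u, hfin.mem_toFinset.2 hu, by simpa [dist_eq_norm] using hxu⟩

open Polynomial in
/-- There are elements of `C` whose residue is not algebraic of small degree over the residue
field of `K`. -/
lemma exists_generic [IsAlgClosed C] (N : ℕ) :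
    ∃ t : C, ∀ (x : Fin N → K) (d : Fin N), (∀ i, ‖x i‖ ≤ ‖x d‖) →
      ‖∑ i, algebraMap K C (x i) * t ^ (i : ℕ)‖ = ‖x d‖ := by
  classical
  obtain ⟨T, hT1, hT⟩ := exists_finset_residues (K := K)
  set low : Fin N → Finset (Fin N) := fun d => Finset.univ.filter fun i => i < d with hlow
  set p : Fin N × (Fin N → K) → C[X] := fun q =>
    X ^ (q.1 : ℕ) + ∑ i ∈ low q.1, Polynomial.C (algebraMap K C (q.2 i)) * X ^ (i : ℕ) with hp
  set S : Finset (Fin N × (Fin N → K)) := Finset.univ ×ˢ Fintype.piFinset fun _ => T with hS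
  have hmonic : ∀ q, (p q).Monic := fun q => by
    refine monic_X_pow_add ((degree_sum_le _ _).trans_lt ?_)
    rw [Finset.sup_lt_iff (WithBot.bot_lt_coe _)]
    intro i hi
    refine (degree_C_mul_X_pow_le _ _).trans_lt ?_
    simpa [hlow] using hi
  have heval : ∀ q (t : C), (p q).eval t =
      t ^ (q.1 : ℕ) + ∑ i ∈ low q.1, algebraMap K C (q.2 i) * t ^ (i : ℕ) := fun q t => by
    simp [hp, eval_finsetSum]
  -- S lists the finitely many monic polynomials of degree below N with coefficients in T. At a root
  -- t of R - 1 the product of |t| and their values is 1; once |t| ≤ 1 no factor exceeds 1, so each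
  -- value has norm 1.
  set R : C[X] := X * ∏ q ∈ S, p q with hR
  have hRm : (∏ q ∈ S, p q).Monic := monic_prod_of_monic _ _ fun q _ => hmonic q
  have hdeg : (R - Polynomial.C 1).degree ≠ 0 := by
    have h1 : (R - Polynomial.C 1).natDegree ≠ 0 := by
      rw [natDegree_sub_C, hR, natDegree_X_mul hRm.ne_zero]
      omega
    intro h
    exact h1 (natDegree_eq_of_degree_eq_some h)
  obtain ⟨t, ht⟩ := IsAlgClosed.exists_root _ hdeg
  have ht1 : ‖t‖ * ∏ q ∈ S, ‖(p q).eval t‖ = 1 := by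
    have : t * ∏ q ∈ S, (p q).eval t = 1 := by
      have := ht
      simp only [IsRoot.def, hR, eval_sub, eval_mul, eval_X, eval_prod, eval_C] at this
      exact sub_eq_zero.1 this
    rw [← norm_prod, ← norm_mul, this, norm_one]
  have hSmem : ∀ q ∈ S, ∀ i, ‖algebraMap K C (q.2 i)‖ ≤ 1 := fun q hq i => by
    rw [norm_algebraMap']
    rw [hS, Finset.mem_product, Fintype.mem_piFinset] at hq
    exact hT1 _ (hq.2 i)
  have htle : ‖t‖ ≤ 1 := by
    -- If |t| > 1, the leading terms dominate, so all values have norm at least 1 and the product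
    -- exceeds 1.
    by_contra! hgt
    have h1 : ∀ q ∈ S, 1 ≤ ‖(p q).eval t‖ := fun q hq => by
      rw [heval, norm_add_eq_left]
      · rw [norm_pow]
        exact one_le_pow₀ hgt.le
      · rw [norm_pow]
        refine norm_sum_lt (by positivity) fun i hi => ?_
        have hi : i < q.1 := by simpa [hlow] using hi
        rw [norm_mul, norm_pow]
        exact (mul_le_of_le_one_left (by positivity) (hSmem q hq i)).trans_lt
          (pow_lt_pow_right₀ hgt hi)
    have h2 := Finset.one_le_prod h1
    nlinarith
  have htpow : ∀ n : ℕ, ‖t ^ n‖ ≤ 1 := fun n => by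
    rw [norm_pow]
    exact pow_le_one₀ (norm_nonneg _) htle
  have hterm : ∀ (c : K) (n : ℕ), ‖algebraMap K C c * t ^ n‖ ≤ ‖c‖ := fun c n => by
    rw [norm_mul, norm_algebraMap']
    exact mul_le_of_le_one_right (norm_nonneg _) (htpow n)
  have hle : ∀ q ∈ S, ‖(p q).eval t‖ ≤ 1 := fun q hq => by
    rw [heval]
    refine (IsUltrametricDist.norm_add_le_max _ _).trans (max_le (htpow _) ?_)
    refine IsUltrametricDist.norm_sum_le_of_forall_le_of_nonneg zero_le_one fun i _ => ?_
    rw [norm_mul]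
    exact mul_le_one₀ (hSmem q hq i) (norm_nonneg _) (htpow _)
  have hone : ∀ q ∈ S, ‖(p q).eval t‖ = 1 := fun q hq => by
    refine le_antisymm (hle q hq) ?_
    rw [← Finset.mul_prod_erase _ _ hq] at ht1
    have h1 : ∏ q ∈ S.erase q, ‖(p q).eval t‖ ≤ 1 :=
      Finset.prod_le_one (fun _ _ => norm_nonneg _) fun i hi => hle i (Finset.mem_of_mem_erase hi)
    have h0 : 0 ≤ ∏ q ∈ S.erase q, ‖(p q).eval t‖ := Finset.prod_nonneg fun _ _ => norm_nonneg _
    have h2 : ‖t‖ * ∏ q ∈ S.erase q, ‖(p q).eval t‖ ≤ 1 := mul_le_one₀ htle h0 h1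
    calc (1 : ℝ) = ‖(p q).eval t‖ * (‖t‖ * ∏ q ∈ S.erase q, ‖(p q).eval t‖) := by
          rw [← ht1]; ring
      _ ≤ _ := mul_le_of_le_one_right (norm_nonneg _) h2
  -- monic polynomials with integral coefficients have norm `1` at `t`
  have hint : ∀ (y : Fin N → K) (d : Fin N), (∀ i, ‖y i‖ ≤ 1) →
      ‖t ^ (d : ℕ) + ∑ i ∈ low d, algebraMap K C (y i) * t ^ (i : ℕ)‖ = 1 := fun y d hy => by
    choose u hu hyu using fun i => hT (y i) (hy i)
    have hq : (d, u) ∈ S := by simp [hS, hu]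
    have h1 := hone _ hq
    rw [heval] at h1
    rw [show t ^ (d : ℕ) + ∑ i ∈ low d, algebraMap K C (y i) * t ^ (i : ℕ) =
      (t ^ (d : ℕ) + ∑ i ∈ low d, algebraMap K C (u i) * t ^ (i : ℕ)) +
        ∑ i ∈ low d, algebraMap K C (y i - u i) * t ^ (i : ℕ) by
      rw [add_assoc, ← Finset.sum_add_distrib]
      congr 1
      refine Finset.sum_congr rfl fun i _ => ?_
      rw [map_sub]
      ring]
    rw [norm_add_eq_left, h1]
    rw [h1]
    exact norm_sum_lt one_pos fun i _ => (hterm _ _).trans_lt (hyu i)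
  refine ⟨t, fun x d₀ hd₀ => ?_⟩
  -- the largest index at which the norm is maximal
  obtain ⟨d, hd, hdmax⟩ := (Finset.univ.filter fun i => ‖x i‖ = ‖x d₀‖).exists_max_image id
    ⟨d₀, by simp⟩
  simp only [Finset.mem_filter, Finset.mem_univ, true_and, id] at hd hdmax
  rw [← hd]
  by_cases h0 : ‖x d‖ = 0
  · have hx : ∀ i, x i = 0 := fun i => by
      have := hd₀ i
      rw [← hd, h0] at this
      simpa using this
    simp [hx]
  · have hpos : 0 < ‖x d‖ := lt_of_le_of_ne (norm_nonneg _) (Ne.symm h0)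
    have hxd : algebraMap K C (x d) ≠ 0 := by
      rw [← norm_pos_iff, norm_algebraMap']
      exact hpos
    have hsplit : ∑ i, algebraMap K C (x i) * t ^ (i : ℕ) =
        algebraMap K C (x d) *
          (t ^ (d : ℕ) + ∑ i ∈ low d, algebraMap K C (x i / x d) * t ^ (i : ℕ)) +
        ∑ i ∈ Finset.univ.filter (fun i => d < i), algebraMap K C (x i) * t ^ (i : ℕ) := by
      rw [mul_add, Finset.mul_sum]
      have h1 : ∑ i ∈ low d, algebraMap K C (x d) * (algebraMap K C (x i / x d) * t ^ (i : ℕ)) =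
          ∑ i ∈ low d, algebraMap K C (x i) * t ^ (i : ℕ) := by
        refine Finset.sum_congr rfl fun i _ => ?_
        rw [map_div₀]
        field_simp
      rw [h1, ← Finset.sum_filter_add_sum_filter_not Finset.univ (fun i => i < d),
        ← Finset.sum_filter_add_sum_filter_not (Finset.univ.filter fun i => ¬ i < d)
          (fun i => d < i), Finset.filter_filter, Finset.filter_filter]
      have e1 : (Finset.univ.filter fun i => ¬ i < d ∧ d < i) =
          Finset.univ.filter fun i => d < i := by
        ext i
        simp only [Finset.mem_filter, Finset.mem_univ, true_and]
        omega
      have e2 : (Finset.univ.filter fun i => ¬ i < d ∧ ¬ d < i) = {d} := by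
        ext i
        simp only [Finset.mem_filter, Finset.mem_univ, true_and, Finset.mem_singleton]
        omega
      rw [e1, e2, Finset.sum_singleton]
      ring
    have h1 := hint (fun i => x i / x d) d fun i => by
      rw [norm_div]
      exact div_le_one_of_le₀ (by rw [hd]; exact hd₀ i) (norm_nonneg _)
    rw [hsplit, norm_add_eq_left, norm_mul, h1, mul_one, norm_algebraMap']
    rw [norm_mul, h1, mul_one, norm_algebraMap']
    refine norm_sum_lt hpos fun i hi => (hterm _ _).trans_lt ?_
    simp only [Finset.mem_filter, Finset.mem_univ, true_and] at hi
    refine lt_of_le_of_ne (by rw [hd]; exact hd₀ i) fun h => ?_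
    exact absurd (hdmax i (h.trans hd)) (not_le.2 hi)

end Generic

end

/-! ### The absolute value of the period pairing. -/

section

variable {K : Type*} [NontriviallyNormedField K] [IsUltrametricDist K] [ProperSpace K]
  {C : Type*} [NormedField C] [NormedAlgebra K C]

/-- Points whose coordinates satisfy no algebraic relation of degree at most three over the residue
field of `K`. -/
def IsGeneric (K : Type*) [NontriviallyNormedField K] [NormedAlgebra K C] (t : C) : Prop :=
  ∀ M : Matrix (Fin 2) (Fin 2) K, ‖wedge ![t ^ 2, 1] (mv M ![t, 1])‖ = entryNorm M

omit [IsUltrametricDist K] in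
variable (K C) in
lemma exists_isGeneric [IsUltrametricDist C] [IsAlgClosed C] :
    ∃ t : C, IsGeneric K t := by
  obtain ⟨t, ht⟩ := exists_generic (K := K) (C := C) 4
  refine ⟨t, fun M => ?_⟩
  -- Pairing t² with t places the four entries at the distinct powers 1, t, t², t³, so none of them
  -- can cancel.
  set x : Fin 4 → K := ![-M 0 1, -M 0 0, M 1 1, M 1 0] with hx
  have h1 : wedge ![t ^ 2, 1] (mv M ![t, 1]) = ∑ i, algebraMap K C (x i) * t ^ (i : ℕ) := by
    simp [wedge, mv, hx, Fin.sum_univ_four]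
    ring
  have h2 : ∀ i, ‖x i‖ ≤ entryNorm M := fun i => by
    fin_cases i <;> simp [hx, norm_le_entryNorm]
  obtain ⟨d, hd⟩ : ∃ d, ‖x d‖ = entryNorm M := by
    obtain ⟨i, j, hij⟩ := exists_norm_eq_entryNorm M
    rw [← hij]
    fin_cases i <;> fin_cases j
    exacts [⟨1, by simp [hx]⟩, ⟨0, by simp [hx]⟩, ⟨3, by simp [hx]⟩, ⟨2, by simp [hx]⟩]
  rw [h1, ht x d fun i => hd.symm ▸ h2 i, hd]

namespace IsGeneric

variable {t : C} (ht : IsGeneric K t)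
include ht

omit [IsUltrametricDist K] [ProperSpace K]

lemma not_mem_range : t ∉ Set.range (algebraMap K C) := by
  rintro ⟨u, rfl⟩
  have := ht !![0, 0; 1, -u]
  simp [wedge, mv, entryNorm] at this
  exact absurd this.symm (lt_of_lt_of_le one_pos (le_max_left 1 ‖u‖)).ne'

lemma sq_not_mem_range : t ^ 2 ∉ Set.range (algebraMap K C) := by
  rintro ⟨u, hu⟩
  have := ht !![0, u; 0, 1]
  rw [wedge] at this
  simp [mv, entryNorm, hu] at this
  exact absurd this.symm (lt_of_lt_of_le one_pos (le_max_right ‖u‖ 1)).ne'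

lemma norm_wedge_mv_lift (g : PGL(2, K)) :
    ‖wedge ![t ^ 2, 1] (mv (lift g).val ![t, 1])‖ = 1 := by
  rw [ht, entryNorm_lift]

/-- Pulling out a multiplies the bracket by its determinant and leaves a bracket for a⁻¹g, to which
genericity applies. -/
lemma norm_wedge_mv_lift_lift (a g : PGL(2, K)) :
    ‖wedge (mv (lift a).val ![t ^ 2, 1]) (mv (lift g).val ![t, 1])‖ ^ 2 =
      rho (a⁻¹ * g) * ‖(lift a).val.det‖ * ‖(lift g).val.det‖ := by
  have h1 : mv (lift g).val (![t, 1] : Fin 2 → C) =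
      mv (lift a).val (mv ((lift a)⁻¹ * lift g).val ![t, 1]) := by
    rw [← mv_mul, ← Units.val_mul, mul_inv_cancel_left]
  have h2 : a⁻¹ * g = ProjGenLinGroup.mk ((lift a)⁻¹ * lift g) := by
    rw [map_mul, map_inv, mk_lift, mk_lift]
  have h3 := norm_ne_zero_iff.2 (det_ne_zero (lift a))
  have h4 := norm_ne_zero_iff.2 (det_ne_zero (lift g))
  rw [h1, wedge_mv, norm_mul, norm_algebraMap', ht, h2, rho_mk, Units.val_mul, Matrix.det_mul,
    Matrix.coe_units_inv, Matrix.det_nonsing_inv, Ring.inverse_eq_inv', norm_mul, norm_inv]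
  field_simp

/-- Each bracket is a square root of a value of `rho` up to determinants, and these cancel in the
cross-ratio. -/
lemma log_norm_crossRatio (α γ δ : PGL(2, K)) :
    Real.log ‖crossRatio (affinePt (t ^ 2)) (act α (affinePt (t ^ 2))) (act δ (affinePt t))
      (act δ (act γ (affinePt t)))‖ =
    Real.log (rho δ) / 2 + Real.log (rho (α⁻¹ * δ * γ)) / 2 - Real.log (rho (δ * γ)) / 2 -
      Real.log (rho (α⁻¹ * δ)) / 2 := by
  have hA := norm_pos_iff.2 (det_ne_zero (lift α))
  have hD := norm_pos_iff.2 (det_ne_zero (lift δ))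
  have hE := norm_pos_iff.2 (det_ne_zero (lift (δ * γ)))
  have h1 := ht.norm_wedge_mv_lift δ
  have h2 := ht.norm_wedge_mv_lift (δ * γ)
  have h3 := ht.norm_wedge_mv_lift_lift α δ
  have h4 := ht.norm_wedge_mv_lift_lift α (δ * γ)
  have h5 : (1 : ℝ) = rho δ * ‖(lift δ).val.det‖ := by rw [rho]; field_simp
  have h6 : (1 : ℝ) = rho (δ * γ) * ‖(lift (δ * γ)).val.det‖ := by rw [rho]; field_simp
  rw [← act_mul, affinePt, affinePt, act_lift, act_lift, act_lift, crossRatio_mk, norm_div,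
    norm_mul, norm_mul, h1, h2, one_mul, one_mul]
  set x := ‖wedge (mv (lift α).val ![t ^ 2, 1]) (mv (lift (δ * γ)).val ![t, 1])‖ with hx
  set y := ‖wedge (mv (lift α).val ![t ^ 2, 1]) (mv (lift δ).val ![t, 1])‖ with hy
  have r1 := rho_pos (α⁻¹ * δ)
  have r2 := rho_pos (α⁻¹ * (δ * γ))
  have r3 := rho_pos δ
  have r4 := rho_pos (δ * γ)
  have hx0 : x ≠ 0 := fun h => by
    rw [h] at h4
    have : 0 < rho (α⁻¹ * (δ * γ)) * ‖(lift α).val.det‖ * ‖(lift (δ * γ)).val.det‖ := by positivity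
    exact this.ne (by rw [← h4, zero_pow two_ne_zero])
  have hy0 : y ≠ 0 := fun h => by
    rw [h] at h3
    have : 0 < rho (α⁻¹ * δ) * ‖(lift α).val.det‖ * ‖(lift δ).val.det‖ := by positivity
    exact this.ne (by rw [← h3, zero_pow two_ne_zero])
  have e3 := congrArg Real.log h3
  have e4 := congrArg Real.log h4
  have e5 := congrArg Real.log h5
  have e6 := congrArg Real.log h6
  rw [Real.log_mul (by positivity) hD.ne', Real.log_mul r1.ne' hA.ne', Real.log_pow] at e3
  rw [Real.log_mul (by positivity) hE.ne', Real.log_mul r2.ne' hA.ne', Real.log_pow] at e4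
  rw [Real.log_one, Real.log_mul r3.ne' hD.ne'] at e5
  rw [Real.log_one, Real.log_mul r4.ne' hE.ne'] at e6
  rw [Real.log_div hx0 hy0, mul_assoc α⁻¹]
  push_cast at e3 e4
  linarith

end IsGeneric

omit [IsUltrametricDist K] in
lemma IsGeneric.admissible {t : C} (ht : IsGeneric K t) {Γ : Subgroup PGL(2, K)}
    (hΓ : IsSchottky Γ) : Admissible Γ (affinePt (t ^ 2)) (affinePt t) := by
  refine ⟨affinePt_mem_ordinarySet hΓ ht.sq_not_mem_range,
    affinePt_mem_ordinarySet hΓ ht.not_mem_range, fun γ h => ?_⟩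
  have h1 := ht.norm_wedge_mv_lift γ
  rw [affinePt, affinePt, act_lift] at h
  rw [(wedge_eq_zero_iff _ _).2 h, norm_zero] at h1
  exact zero_ne_one h1

variable [IsUltrametricDist C] [CompleteSpace C]

/-- The absolute value of the period pairing is given by the intersection form of the quotient
graph. -/
lemma IsGeneric.norm_period {t : C} (ht : IsGeneric K t) {Γ : Subgroup PGL(2, K)}
    (hΓ : IsSchottky Γ) {π : K} (hπ : IsUniformizer π) {γ α : Γ} {l m : List PGL(2, K)}
    (hl : EdgePath (vertexStab K) (diagElt π hπ.ne_zero) 1 γ l)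
    (hm : EdgePath (vertexStab K) (diagElt π hπ.ne_zero) 1 α m) :
    ‖period (affinePt (t ^ 2)) (affinePt t) γ α‖ = Real.exp (Real.log ‖π‖ *
      (ip (pathChain Γ (vertexStab K) (diagElt π hπ.ne_zero) (swapElt K) m)
        (pathChain Γ (vertexStab K) (diagElt π hπ.ne_zero) (swapElt K) l) : ℤ)) := by
  have hadm := ht.admissible hΓ
  have hreg := hadm.regular_act (hadm.act_left α) γ
  -- The norms of the factors and the exponentials of the second differences form the same product,
  -- whose value is unique.
  have h1 := (hreg.multipliable hΓ).hasProd.norm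
  have h2 := ((treePotential hπ).hasSum (treeDatum hΓ hπ) hl hm).rexp
  refine h1.unique ?_
  convert h2 using 2 with δ
  rw [Function.comp_apply, ← ht.log_norm_crossRatio, Real.exp_log]
  exact norm_pos_iff.2 (crossRatio_ne_zero (hreg.za δ) (hreg.zb δ) (hreg.wa δ) (hreg.wb δ))

end

section

/-! ### Formal consequences of a polarization. -/

section Polarization

variable {O : Type*}

lemma ip_sub_left (F F' G : O →₀ ℤ) : ip (F - F') G = ip F G - ip F' G := by
  rw [sub_eq_add_neg, ip_add_left, ip_neg_left, sub_eq_add_neg]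

lemma ip_sub_right (F G G' : O →₀ ℤ) : ip F (G - G') = ip F G - ip F G' := by
  rw [sub_eq_add_neg, ip_add_right, ip_neg_right, sub_eq_add_neg]

lemma finite_ip_self_le (E : Finset O) (N : ℤ) :
    {G : O →₀ ℤ | G.support ⊆ E ∧ ip G G ≤ N}.Finite := by
  refine (Finset.finite_toSet (E.finsupp fun _ => Finset.Icc (-N) N)).subset ?_
  rintro G ⟨h1, h2⟩
  refine Finset.mem_coe.2 (Finset.mem_finsupp_iff.2 ⟨h1, fun o _ => ?_⟩)
  have h3 := (sq_le_ip_self G o).trans h2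
  rw [Finset.mem_Icc]
  constructor <;> nlinarith [sq_nonneg (G o)]

/-- Completing the square absorbs a linear form into an arbitrarily small multiple of the quadratic
form. -/
lemma sum_mul_le_ip_self {E : Finset O} {G : O →₀ ℤ} (h : G.support ⊆ E) (L : O → ℝ) {s : ℝ}
    (hs : 0 < s) :
    ∑ o ∈ E, (G o : ℝ) * L o ≤ s * (ip G G : ℤ) + ∑ o ∈ E, L o ^ 2 / (4 * s) := by
  have h1 : ip G G = ∑ o ∈ E, G o ^ 2 := by
    rw [ip_self]
    refine Finset.sum_subset h fun o _ ho => ?_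
    rw [Finsupp.notMem_support_iff.1 ho, zero_pow two_ne_zero]
  rw [h1]
  push_cast
  rw [Finset.mul_sum, ← Finset.sum_add_distrib]
  refine Finset.sum_le_sum fun o _ => ?_
  have h2 : s * (G o : ℝ) ^ 2 + L o ^ 2 / (4 * s) - G o * L o =
      (2 * s * G o - L o) ^ 2 / (4 * s) := by
    field_simp
    ring
  have h3 : 0 ≤ (2 * s * G o - L o) ^ 2 / (4 * s) := by positivity
  linarith

variable {Γ : Type*} [Group Γ] {C : Type*} [NormedField C]

/-- A bimultiplicative pairing `q` on `Γ` whose absolute value is the exponential of a negative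
multiple of the intersection form of `F γ`, such that all characters of `Γ` factor through `F`. -/
structure IsPolarization (q : Γ →* Γ →* Cˣ) (F : Γ → O →₀ ℤ) (r : ℝ) : Prop where
  neg : r < 0
  symm : ∀ α β, q α β = q β α
  norm_eq : ∀ α β, ‖(q α β : C)‖ = Real.exp (r * (ip (F β) (F α) : ℤ))
  cochain : ∀ c : Γ →* Cˣ, ∃ φ : O → Cˣ, ∀ γ, c γ = (F γ).prod fun o n => φ o ^ n

namespace IsPolarization

variable {q : Γ →* Γ →* Cˣ} {F : Γ → O →₀ ℤ} {r : ℝ} (h : IsPolarization q F r)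
include h

lemma ip_map_mul (α β γ : Γ) : ip (F (α * β)) (F γ) = ip (F α) (F γ) + ip (F β) (F γ) := by
  have h1 : ‖(q γ (α * β) : C)‖ = ‖(q γ α : C)‖ * ‖(q γ β : C)‖ := by
    rw [map_mul, Units.val_mul, norm_mul]
  rw [h.norm_eq, h.norm_eq, h.norm_eq, ← Real.exp_add, Real.exp_eq_exp, ← mul_add] at h1
  exact_mod_cast mul_left_cancel₀ h.neg.ne h1

/-- The defect is orthogonal to all values of F, hence to itself. Additivity is thus forced by the
pairing, although F comes from arbitrarily chosen paths. -/
lemma map_mul (α β : Γ) : F (α * β) = F α + F β := by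
  have h1 : ∀ γ, ip (F (α * β) - (F α + F β)) (F γ) = 0 := fun γ => by
    rw [ip_sub_left, ip_add_left, h.ip_map_mul, sub_self]
  refine sub_eq_zero.1 (ip_self_eq_zero ?_)
  rw [ip_sub_right, ip_add_right, h1, h1, h1, add_zero, sub_zero]

lemma char_eq {γ δ : Γ} (hF : F γ = F δ) (c : Γ →* Cˣ) : c γ = c δ := by
  obtain ⟨φ, hφ⟩ := h.cochain c
  rw [hφ, hφ, hF]

/-- Definiteness gives one direction; the other holds because characters see γ only through F γ. -/
lemma eq_iff {γ δ : Γ} : q γ = q δ ↔ F γ = F δ := by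
  constructor
  · intro hq
    have h1 : ∀ β, ip (F γ - F δ) (F β) = 0 := fun β => by
      have h2 : ‖(q β γ : C)‖ = ‖(q β δ : C)‖ := by rw [h.symm, hq, h.symm]
      rw [h.norm_eq, h.norm_eq, Real.exp_eq_exp] at h2
      rw [ip_sub_left, sub_eq_zero]
      exact_mod_cast mul_left_cancel₀ h.neg.ne h2
    refine sub_eq_zero.1 (ip_self_eq_zero ?_)
    rw [ip_sub_right, h1, h1, sub_zero]
  · intro hF
    ext α
    rw [h.symm, h.char_eq hF, h.symm]

lemma char_eq_of_eq {γ δ : Γ} (hq : q γ = q δ) (c : Γ →* Cˣ) : c γ = c δ :=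
  h.char_eq (h.eq_iff.1 hq) c

/-- The map `F` as a homomorphism. -/
def hom : Additive Γ →+ (O →₀ ℤ) := AddMonoidHom.mk' (fun γ => F γ.toMul) fun _ _ => h.map_mul _ _

lemma exists_support_subset [Group.FG Γ] : ∃ E : Finset O, ∀ γ, (F γ).support ⊆ E := by
  classical
  obtain ⟨S, hS⟩ := Group.FG.out (G := Γ)
  refine ⟨S.biUnion fun γ => (F γ).support, fun γ => ?_⟩
  have hγ : γ ∈ Subgroup.closure (S : Set Γ) := hS ▸ Subgroup.mem_top γ
  induction hγ using Subgroup.closure_induction with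
  | mem x hx => exact Finset.subset_biUnion_of_mem (fun γ => (F γ).support) hx
  | one =>
    have : F 1 = 0 := h.hom.map_zero
    simp [this]
  | mul x y _ _ hx hy =>
    rw [h.map_mul]
    exact Finsupp.support_add.trans (Finset.union_subset hx hy)
  | inv x _ hx =>
    have : F x⁻¹ = -F x := h.hom.map_neg (Additive.ofMul x)
    rwa [this, Finsupp.support_neg]

lemma exists_norm_le [Group.FG Γ] (c : Γ →* Cˣ) {s : ℝ} (hs : 0 < s) :
    ∃ M : ℝ, ∀ γ, ‖(c γ : C)‖ ≤ Real.exp (s * (ip (F γ) (F γ) : ℤ) + M) := by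
  obtain ⟨E, hE⟩ := h.exists_support_subset
  obtain ⟨φ, hφ⟩ := h.cochain c
  refine ⟨∑ o ∈ E, Real.log ‖(φ o : C)‖ ^ 2 / (4 * s), fun γ => ?_⟩
  have h1 : Real.log ‖(c γ : C)‖ = ∑ o ∈ E, (F γ o : ℝ) * Real.log ‖(φ o : C)‖ := by
    rw [hφ, Finsupp.prod_of_support_subset _ (hE γ) _ (by simp), Units.coe_prod, norm_prod,
      Real.log_prod fun o _ => norm_ne_zero_iff.2 (Units.ne_zero _)]
    refine Finset.sum_congr rfl fun o _ => ?_
    rw [Units.val_zpow_eq_zpow_val, norm_zpow, Real.log_zpow]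
  rw [← Real.log_le_iff_le_exp (norm_pos_iff.2 (Units.ne_zero _)), h1]
  exact sum_mul_le_ip_self (hE γ) _ hs

/-- The general term of the theta series tends to zero. -/
lemma tendsto_norm [Group.FG Γ] (c : Γ →* Cˣ) {Λ : Type*} {g : Λ → Γ}
    (hg : Function.Injective fun l => q (g l)) {p : Λ → C} (hp : ∀ l, p l ^ 2 = q (g l) (g l)) :
    Tendsto (fun l => p l * c (g l)) cofinite (𝓝 0) := by
  -- The norm of p decays at rate r / 2; allowing c to grow at half that rate leaves r / 4.
  have hr : 0 < -r / 4 := by linarith [h.neg]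
  obtain ⟨E, hE⟩ := h.exists_support_subset
  obtain ⟨M, hM⟩ := h.exists_norm_le c hr
  have hFg : Function.Injective fun l => F (g l) := fun l m hlm => hg (h.eq_iff.2 hlm)
  have htop : Tendsto (fun l => ((ip (F (g l)) (F (g l)) : ℤ) : ℝ)) cofinite atTop := by
    refine tendsto_intCast_atTop_atTop.comp (tendsto_atTop.2 fun N => ?_)
    rw [eventually_cofinite]
    refine ((finite_ip_self_le E N).preimage (hFg.injOn (s := Set.univ) |>.mono
      (Set.subset_univ _))).subset fun l hl => ⟨hE _, (not_le.1 hl).le⟩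
  have h1 : ∀ l, ‖p l‖ = Real.exp (r * (ip (F (g l)) (F (g l)) : ℤ) / 2) := fun l => by
    rw [← pow_left_inj₀ (norm_nonneg _) (Real.exp_nonneg _) two_ne_zero, ← norm_pow, hp,
      h.norm_eq, ← Real.exp_nat_mul]
    congr 1
    push_cast
    ring
  have h2 : Tendsto (fun l => Real.exp (r / 4 * (ip (F (g l)) (F (g l)) : ℤ) + M)) cofinite
      (𝓝 0) := by
    refine Real.tendsto_exp_atBot.comp (tendsto_atBot_add_const_right _ _ ?_)
    exact htop.const_mul_atTop_of_neg (by linarith [h.neg])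
  refine squeeze_zero_norm (fun l => ?_) h2
  rw [norm_mul, h1]
  refine (mul_le_mul_of_nonneg_left (hM _) (Real.exp_nonneg _)).trans_eq ?_
  rw [← Real.exp_add]
  congr 1
  ring

/-- A symmetric bimultiplicative square root of the pairing. -/
lemma exists_root [Group.FG Γ] [IsAlgClosed C] : ∃ B : Γ → Γ → Cˣ,
    (∀ α β, B α β = B β α) ∧ (∀ α β γ, B (α * β) γ = B α γ * B β γ) ∧
    (∀ α α' β, q α = q α' → B α β = B α' β) ∧ ∀ α β, B α β ^ 2 = q α β := by
  have hsqrt : ∀ u : Cˣ, ∃ v : Cˣ, v ^ 2 = u := fun u => by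
    obtain ⟨v, hv⟩ := IsAlgClosed.exists_pow_nat_eq (u : C) two_pos
    have hv0 : v ≠ 0 := fun h0 => u.ne_zero (by rw [← hv, h0, zero_pow two_ne_zero])
    exact ⟨Units.mk0 v hv0, Units.ext hv⟩
  choose s hs using hsqrt
  -- The image of F is finitely generated and torsion-free, hence free. Characters are determined by
  -- their values on a basis, so square roots chosen for pairs of basis elements extend
  -- bimultiplicatively.
  let V : Submodule ℤ (O →₀ ℤ) := AddSubgroup.toIntSubmodule h.hom.range
  have hFV : ∀ γ, F γ ∈ V := fun γ => ⟨Additive.ofMul γ, rfl⟩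
  have : Module.Finite ℤ V := by
    rw [Module.Finite.iff_addGroup_fg]
    exact AddGroup.fg_range h.hom
  let b := Module.Free.chooseBasis ℤ V
  have hb : ∀ i, ∃ γ, F γ = b i := fun i => by
    obtain ⟨γ, hγ⟩ := (b i).2
    exact ⟨γ.toMul, hγ⟩
  choose e he using hb
  let x (γ : Γ) : _ →₀ ℤ := b.repr ⟨F γ, hFV γ⟩
  have hx : ∀ α β, x (α * β) = x α + x β := fun α β => by
    rw [← map_add]
    exact congrArg b.repr (Subtype.ext (h.map_mul α β))
  have hc : ∀ (c : Γ →* Cˣ) γ, c γ = ∏ i, c (e i) ^ x γ i := fun c γ => by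
    obtain ⟨φ, hφ⟩ := h.cochain c
    let Φ : (O →₀ ℤ) →+ Additive Cˣ :=
      Finsupp.liftAddHom fun o => zmultiplesHom _ (Additive.ofMul (φ o))
    have hΦ : ∀ γ, Φ (F γ) = Additive.ofMul (c γ) := fun γ => by
      rw [hφ]
      rfl
    have h1 : F γ = ∑ i, x γ i • F (e i) := by
      have h2 := congrArg V.subtype (b.sum_repr ⟨F γ, hFV γ⟩)
      rw [map_sum] at h2
      simpa [he] using h2.symm
    have h3 := congrArg Φ h1
    rw [map_sum, hΦ] at h3
    simp only [map_zsmul, hΦ] at h3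
    exact h3
  refine ⟨fun α β => ∏ i, ∏ j, s (q (e i) (e j)) ^ (x α i * x β j), fun α β => ?_,
    fun α β γ => ?_, fun α α' β hq => ?_, fun α β => ?_⟩
  · dsimp only
    rw [Finset.prod_comm]
    refine Finset.prod_congr rfl fun i _ => Finset.prod_congr rfl fun j _ => ?_
    rw [h.symm, mul_comm]
  · simp only [hx, Finsupp.add_apply, add_mul, _root_.zpow_add, Finset.prod_mul_distrib]
  · have : x α = x α' := congrArg b.repr (Subtype.ext (h.eq_iff.1 hq))
    simp only [this]
  · rw [hc (q α) β]
    have h1 : ∀ j, q α (e j) = ∏ i, q (e i) (e j) ^ x α i := fun j => by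
      rw [h.symm, hc]
      exact Finset.prod_congr rfl fun i _ => by rw [h.symm]
    simp only [h1, ← Finset.prod_pow, ← Finset.prod_zpow]
    rw [Finset.prod_comm]
    refine Finset.prod_congr rfl fun i _ => Finset.prod_congr rfl fun j _ => ?_
    rw [← zpow_natCast, zpow_comm, zpow_natCast, hs, _root_.zpow_mul]

end IsPolarization

end Polarization

end

/-! ### The Riemann theta function. -/

section

variable {K : Type*} [NontriviallyNormedField K] {C : Type*} [NormedField C] [NormedAlgebra K C]

lemma IsGeneric.exists_isPolarization [IsUltrametricDist K] [ProperSpace K] [IsUltrametricDist C]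
    [CompleteSpace C] {t : C} (ht : IsGeneric K t) {Γ : Subgroup PGL(2, K)} (hΓ : IsSchottky Γ)
    {π : K} (hπ : IsUniformizer π) :
    ∃ F : Γ → EdgeOrbit Γ (vertexStab K) (diagElt π hπ.ne_zero) →₀ ℤ,
      IsPolarization (periodHom hΓ (ht.admissible hΓ)) F (Real.log ‖π‖) := by
  choose l hl using fun γ : Γ => exists_edgePath hπ 1 (γ : PGL(2, K))
  refine ⟨fun γ => pathChain Γ _ _ (swapElt K) (l γ), Real.log_neg hπ.pos hπ.lt_one,
    fun α β => Units.ext ?_, fun α β => ht.norm_period hΓ hπ (hl α) (hl β), fun c => ?_⟩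
  · have h := ht.admissible hΓ
    rw [periodHom_apply, periodHom_apply, period_symm, period_eq hΓ ht.not_mem_range h.symm h]
  · obtain ⟨φ, hφ⟩ := (treeDatum hΓ hπ).exists_cochain c
    exact ⟨φ, fun γ => hφ γ _ (hl γ)⟩

section Theta

variable {Γ : Subgroup PGL(2, K)} {a : P1 C} {q : Γ →* CharGroup C Γ} {O : Type*}
  {F : Γ → O →₀ ℤ} {r : ℝ}

lemma exists_isPeriodRoot [IsAlgClosed C] [Group.FG Γ] (h : IsPolarization q F r)
    (hq : ∀ γ, periodChar Γ a γ = q γ)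
    (hQ : ∀ α β : Γ, ∀ w ∈ regularSet Γ a (act (α : PGL(2, K)) a),
      ∀ z ∈ regularSet Γ a (act (α : PGL(2, K)) a),
        (q α β : C) = theta Γ w a (act (α : PGL(2, K)) a) z /
          theta Γ w a (act (α : PGL(2, K)) a) (act (β : PGL(2, K)) z)) :
    ∃ P : periodLattice Γ a → periodLattice Γ a → Cˣ, IsPeriodRoot Γ a P := by
  obtain ⟨B, hsymm, hmul, hcongr, hsq⟩ := h.exists_root
  have hl : ∀ l : periodLattice Γ a, q l.2.choose = l := fun l => by
    rw [← hq, l.2.choose_spec]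
  refine ⟨fun l m => B l.2.choose m.2.choose, fun _ _ => hsymm _ _, fun k l m n hk => ?_,
    fun α β w hw z hz => ?_⟩
  · rw [← hmul]
    refine hcongr _ _ _ ?_
    rw [map_mul, hl, hl, hl, hk]
  · have hα : q (periodElt Γ a α).2.choose = q α := (hl _).trans (hq α)
    have hβ : q (periodElt Γ a β).2.choose = q β := (hl _).trans (hq β)
    rw [← hQ α β w hw z hz, hcongr _ _ _ hα, hsymm, hcongr _ _ _ hβ, hsymm, ← hsq]
    push_cast
    rfl

variable {P : periodLattice Γ a → periodLattice Γ a → Cˣ}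

lemma periodElt_surjective (l : periodLattice Γ a) : ∃ γ, periodElt Γ a γ = l := by
  obtain ⟨l, γ, rfl⟩ := l
  exact ⟨γ, rfl⟩

/-- In the bimultiplicative expansion the two equal cross terms multiply to P², which is Q. -/
lemma IsPeriodRoot.mul_periodElt (hP : IsPeriodRoot Γ a P) (hq : ∀ γ, periodChar Γ a γ = q γ)
    (hsq : ∀ α β, P (periodElt Γ a α) (periodElt Γ a β) ^ 2 = q α β) (α β : Γ) :
    P (periodElt Γ a (α * β)) (periodElt Γ a (α * β)) =
      P (periodElt Γ a α) (periodElt Γ a α) * periodChar Γ a α β *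
        P (periodElt Γ a β) (periodElt Γ a β) := by
  have h1 : ((periodElt Γ a (α * β) : periodLattice Γ a) : CharGroup C Γ) =
      (periodElt Γ a α : periodLattice Γ a) * (periodElt Γ a β : periodLattice Γ a) := by
    change periodChar Γ a (α * β) = periodChar Γ a α * periodChar Γ a β
    rw [hq, hq, hq, map_mul]
  rw [hP.mul_left _ _ _ _ h1, hP.symm (periodElt Γ a α), hP.symm (periodElt Γ a β),
    hP.mul_left _ _ _ _ h1, hP.mul_left _ _ _ _ h1, hP.symm (periodElt Γ a β), hq, ← hsq, pow_two]
  simp only [mul_assoc]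

/-- The element chosen in `xi` may differ from α, but it has the same period character, so every c
takes the same value on it. -/
lemma xi_periodElt (h : IsPolarization q F r) (hq : ∀ γ, periodChar Γ a γ = q γ) (α : Γ)
    (c : CharGroup C Γ) :
    xi P (periodElt Γ a α) c = P (periodElt Γ a α) (periodElt Γ a α) * c α := by
  rw [xi]
  congr 1
  refine h.char_eq_of_eq ?_ c
  rw [← hq, ← hq]
  exact (periodElt Γ a α).2.choose_spec

lemma summable_xi [IsUltrametricDist C] [CompleteSpace C] [Group.FG Γ] (h : IsPolarization q F r)
    (hq : ∀ γ, periodChar Γ a γ = q γ)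
    (hsq : ∀ α β, P (periodElt Γ a α) (periodElt Γ a β) ^ 2 = q α β) (c : CharGroup C Γ) :
    Summable fun l : periodLattice Γ a => (xi P l c : C) := by
  refine NonarchimedeanAddGroup.summable_of_tendsto_cofinite_zero ?_
  have hl : ∀ l : periodLattice Γ a, q l.2.choose = l := fun l => by
    rw [← hq, l.2.choose_spec]
  refine h.tendsto_norm c (g := fun l : periodLattice Γ a => l.2.choose)
    (p := fun l => (P l l : C)) (fun l m hlm => ?_) fun l => ?_
  · exact Subtype.ext (by simpa only [hl] using hlm)
  · have h1 : periodElt Γ a l.2.choose = l := Subtype.ext l.2.choose_spec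
    have h2 := hsq l.2.choose l.2.choose
    rw [h1] at h2
    exact congrArg Units.val h2

/-- Multiplication by c_α permutes the lattice, and symmetry of the pairing turns the cocycle rule
into ξ_{l c_α}(c) = ξ_{c_α}(c) ξ_l(c c_α). -/
lemma riemannTheta_mul_periodChar (hP : IsPeriodRoot Γ a P) (h : IsPolarization q F r)
    (hq : ∀ γ, periodChar Γ a γ = q γ)
    (hsq : ∀ α β, P (periodElt Γ a α) (periodElt Γ a β) ^ 2 = q α β) (α : Γ)
    (c : CharGroup C Γ) :
    riemannTheta P (c * periodChar Γ a α) =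
      ((xi P (periodElt Γ a α) c)⁻¹ : Cˣ) * riemannTheta P c := by
  have hmem : ∀ (β : Γ) (l : periodLattice Γ a),
      (l : CharGroup C Γ) * q β ∈ periodLattice Γ a := fun β l => by
    obtain ⟨γ, hγ⟩ := l.2
    exact ⟨γ * β, by rw [← hγ, hq, hq, map_mul]⟩
  let e : periodLattice Γ a ≃ periodLattice Γ a :=
    { toFun := fun l => ⟨_, hmem α l⟩
      invFun := fun l => ⟨_, hmem α⁻¹ l⟩
      left_inv := fun l => Subtype.ext (MonoidHom.ext fun γ => by
        change (l : CharGroup C Γ) γ * q α γ * q α⁻¹ γ = (l : CharGroup C Γ) γ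
        rw [map_inv, MonoidHom.inv_apply, mul_inv_cancel_right])
      right_inv := fun l => Subtype.ext (by simp) }
  have he : ∀ γ, e (periodElt Γ a γ) = periodElt Γ a (γ * α) := fun γ =>
    Subtype.ext (by
      change periodChar Γ a γ * q α = periodChar Γ a (γ * α)
      rw [hq, hq, map_mul])
  have h1 : ∀ l, xi P (e l) c = xi P (periodElt Γ a α) c * xi P l (c * periodChar Γ a α) := by
    intro l
    obtain ⟨γ, rfl⟩ := periodElt_surjective l
    rw [he, xi_periodElt h hq, xi_periodElt h hq, xi_periodElt h hq, hP.mul_periodElt hq hsq,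
      MonoidHom.mul_apply, map_mul, hq, hq, h.symm α γ]
    simp only [mul_comm, mul_left_comm, mul_assoc]
  rw [Units.val_inv_eq_inv_val, eq_inv_mul_iff_mul_eq₀ (Units.ne_zero _), riemannTheta,
    riemannTheta, ← tsum_mul_left, ← e.tsum_eq fun l => (xi P l c : C)]
  exact tsum_congr fun l => by rw [h1, Units.val_mul]

end Theta

end

end Mumford

end

theorem mainTheorem7
    {K : Type*} [NontriviallyNormedField K] [IsUltrametricDist K] [ProperSpace K]
    {C : Type*} [NormedField C] [NormedAlgebra K C] [IsUltrametricDist C] [CompleteSpace C]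
    [IsAlgClosed C]
    (Γ : Subgroup PGL(2, K)) (hΓ : Mumford.IsSchottky Γ)
    (a : Mumford.P1 C) (ha : a ∈ Mumford.ordinarySet C Γ) :
    -- `θ(b, γ b; ·)` converges and has automorphy factor `c_γ`, whatever the base point `b ∈ Ω`
    (∀ γ : Γ, ∀ b ∈ Mumford.ordinarySet C Γ,
      (∀ w ∈ Mumford.regularSet Γ b (Mumford.act (γ : PGL(2, K)) b),
        ∀ z ∈ Mumford.regularSet Γ b (Mumford.act (γ : PGL(2, K)) b),
          Multipliable (fun δ : Γ => Mumford.crossRatio z w (Mumford.act (δ : PGL(2, K)) b)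
            (Mumford.act (δ : PGL(2, K)) (Mumford.act (γ : PGL(2, K)) b))) ∧
          Mumford.theta Γ w b (Mumford.act (γ : PGL(2, K)) b) z ≠ 0) ∧
      Mumford.IsAutomorphyFactor Γ b (Mumford.act (γ : PGL(2, K)) b)
        (Mumford.periodChar Γ a γ)) ∧
    -- a square root `P` of the period form exists, and the results hold for every choice of it
    (∃ P : Mumford.periodLattice Γ a → Mumford.periodLattice Γ a → Cˣ,
      Mumford.IsPeriodRoot Γ a P) ∧
    ∀ P : Mumford.periodLattice Γ a → Mumford.periodLattice Γ a → Cˣ,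
      Mumford.IsPeriodRoot Γ a P →
      (∀ α β : Γ,
        P (Mumford.periodElt Γ a (α * β)) (Mumford.periodElt Γ a (α * β)) =
          P (Mumford.periodElt Γ a α) (Mumford.periodElt Γ a α) * Mumford.periodChar Γ a α β *
            P (Mumford.periodElt Γ a β) (Mumford.periodElt Γ a β)) ∧
      (∀ (α : Γ) (c : Mumford.CharGroup C Γ),
        Mumford.xi P (Mumford.periodElt Γ a α) c =
          P (Mumford.periodElt Γ a α) (Mumford.periodElt Γ a α) * c α) ∧
      ∀ c : Mumford.CharGroup C Γ,
        Summable (fun l : Mumford.periodLattice Γ a => (Mumford.xi P l c : C)) ∧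
        ∀ α : Γ,
          Mumford.riemannTheta P (c * Mumford.periodChar Γ a α) =
            ((Mumford.xi P (Mumford.periodElt Γ a α) c)⁻¹ : Cˣ) * Mumford.riemannTheta P c := by
  obtain ⟨t, ht⟩ := Mumford.exists_isGeneric K C
  obtain ⟨π, hπ⟩ := Mumford.exists_isUniformizer (K := K)
  obtain ⟨F, hF⟩ := ht.exists_isPolarization hΓ hπ
  have hadm := ht.admissible hΓ
  have : Group.FG Γ := (Group.fg_iff_subgroup_fg Γ).2 hΓ.fg
  set q := Mumford.periodHom hΓ hadm
  have hq : ∀ γ, Mumford.periodChar Γ a γ = q γ := Mumford.periodChar_eq hΓ ht.not_mem_range hadm ha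
  have haut : ∀ γ : Γ, ∀ b ∈ Mumford.ordinarySet C Γ,
      Mumford.IsAutomorphyFactor Γ b (Mumford.act (γ : PGL(2, K)) b) (q γ) :=
    fun γ b hb => Mumford.isAutomorphyFactor_periodHom hΓ ht.not_mem_range hadm γ hb
  have hQ : ∀ α β : Γ, ∀ w ∈ Mumford.regularSet Γ a (Mumford.act (α : PGL(2, K)) a),
      ∀ z ∈ Mumford.regularSet Γ a (Mumford.act (α : PGL(2, K)) a),
        (q α β : C) = Mumford.theta Γ w a (Mumford.act (α : PGL(2, K)) a) z /
          Mumford.theta Γ w a (Mumford.act (α : PGL(2, K)) a)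
            (Mumford.act (β : PGL(2, K)) z) := by
    intro α β w hw z hz
    have hw' := Mumford.admissible_of_mem_regularSet ha hw
    have hz' := Mumford.admissible_of_mem_regularSet ha hz
    rw [eq_div_iff (Mumford.theta_ne_zero hΓ ((hz'.act_left β).regular_act hw' α))]
    exact (haut α a ha w hw z hz β).symm
  refine ⟨fun γ b hb => ⟨fun w hw z hz => ?_, hq γ ▸ haut γ b hb⟩,
    Mumford.exists_isPeriodRoot hF hq hQ, fun P hP => ?_⟩
  · have hreg := (Mumford.admissible_of_mem_regularSet hb hz).regular_act
      (Mumford.admissible_of_mem_regularSet hb hw) γ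
    exact ⟨hreg.multipliable hΓ, Mumford.theta_ne_zero hΓ hreg⟩
  -- The condition P² = Q is stated at regular points only, so one such point is needed to extract
  -- P² = q.
  · obtain ⟨v, hv, -⟩ := Mumford.exists_admissible hΓ ht.not_mem_range ha ha
    have hsq : ∀ α β, P (Mumford.periodElt Γ a α) (Mumford.periodElt Γ a β) ^ 2 = q α β := by
      intro α β
      have hv' : v ∈ Mumford.regularSet Γ a (Mumford.act (α : PGL(2, K)) a) :=
        (Mumford.mem_regularSet_iff α).2 ⟨hv.hz, hv.sep⟩
      refine Units.ext ?_
      rw [Units.val_pow_eq_pow_val, hP.sq α β v hv' v hv', hQ α β v hv' v hv']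
    exact ⟨hP.mul_periodElt hq hsq, Mumford.xi_periodElt hF hq, fun c =>
      ⟨Mumford.summable_xi hF hq hsq c,
        fun α => Mumford.riemannTheta_mul_periodChar hP hF hq hsq α c⟩⟩
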